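/- Let $\beta\in\{1,2,4\}$ and let $\mathbb F_\beta$ be $\mathbb R$, $\mathbb C$ or the real quaternions $\mathbb H$, respectively. For $n\times N$ matrices $A$ over $\mathbb F_\beta$ let $A^\dagger$ be the conjugate transpose and let $(\mathrm dA)$ denote Lebesgue measure in the $\beta nN$ real coordinates of the entries of $A$; densities below are taken with respect to $(\mathrm dA)$. For a positive semidefinite Hermitian $N\times N$ matrix $W$ over $\mathbb F_\beta$, let $W^{1/2}$ be its positive semidefinite square root and let $\det W$ be the product of its $N$ eigenvalues (for $\beta=4$ each eigenvalue, which is a double eigenvalue of the $2N\times 2N$ complex representation of $W$, is counted once). Put $\sigma_l=2\pi^{l/2}/\Gamma(l/2)$, the surface area of the unit sphere in $\mathbb R^l$. Let $n\ge N$, and let $M$ be a random $n\times N$ matrix over $\mathbb F_\beta$ with probability density function of the form $P(M^\dagger M)$. Let $U$ be a random $N\times N$ unitary matrix over $\mathbb F_\beta$ (an element of $\mathrm O(N)$, $\mathrm U(N)$ or the compact symplectic group, for $\beta=1,2,4$) that is independent of $M$ and distributed according to normalised Haar measure. Then the random $N\times N$ matrix $K=U(M^\dagger M)^{1/2}$ has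 probability density function $$\prod_{i=1}^N\frac{\sigma_{\beta(n-i+1)}}{\sigma_{\beta(N-i+1)}}\;(\det K^\dagger K)^{\beta(n-N)/2}\,P(K^\dagger K).$$ -/

import Mathlib

open MeasureTheory ProbabilityTheory
open scoped Matrix Quaternion

/-- The three kinds of matrix entries. -/
inductive EntryKind : Type
  | real
  | complex
  | quaternion

namespace EntryKind

/-- The Dyson index `β = 1, 2, 4`. -/
def beta : EntryKind → ℕ
  | real => 1
  | complex => 2
  | quaternion => 4

/-- The algebra `𝔽_β`, that is `ℝ`, `ℂ` or the real quaternions `ℍ`. -/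
def Entry : EntryKind → Type
  | real => ℝ
  | complex => ℂ
  | quaternion => ℍ[ℝ]

noncomputable instance (b : EntryKind) : NormedDivisionRing b.Entry :=
  match b with
  | real => inferInstanceAs (NormedDivisionRing ℝ)
  | complex => inferInstanceAs (NormedDivisionRing ℂ)
  | quaternion => inferInstanceAs (NormedDivisionRing ℍ[ℝ])

/-- Conjugation: trivial on `ℝ`, complex conjugation on `ℂ`, quaternion conjugation on `ℍ`. -/
noncomputable instance (b : EntryKind) : StarRing b.Entry :=
  match b with
  | real => inferInstanceAs (StarRing ℝ)
  | complex => inferInstanceAs (StarRing ℂ)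
  | quaternion => inferInstanceAs (StarRing ℍ[ℝ])

noncomputable instance (b : EntryKind) : NormedAlgebra ℝ b.Entry :=
  match b with
  | real => inferInstanceAs (NormedAlgebra ℝ ℝ)
  | complex => inferInstanceAs (NormedAlgebra ℝ ℂ)
  | quaternion => inferInstanceAs (NormedAlgebra ℝ ℍ[ℝ])

noncomputable instance (b : EntryKind) : Inner ℝ b.Entry :=
  match b with
  | real => inferInstanceAs (Inner ℝ ℝ)
  | complex => inferInstanceAs (Inner ℝ ℂ)
  | quaternion => inferInstanceAs (Inner ℝ ℍ[ℝ])

noncomputable instance (b : EntryKind) : InnerProductSpace ℝ b.Entry where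
  norm_sq_eq_re_inner := by
    cases b
    · exact InnerProductSpace.norm_sq_eq_re_inner (𝕜 := ℝ) (E := ℝ)
    · exact InnerProductSpace.norm_sq_eq_re_inner (𝕜 := ℝ) (E := ℂ)
    · exact InnerProductSpace.norm_sq_eq_re_inner (𝕜 := ℝ) (E := ℍ[ℝ])
  conj_inner_symm := by
    cases b
    · exact InnerProductSpace.conj_inner_symm (𝕜 := ℝ) (E := ℝ)
    · exact InnerProductSpace.conj_inner_symm (𝕜 := ℝ) (E := ℂ)
    · exact InnerProductSpace.conj_inner_symm (𝕜 := ℝ) (E := ℍ[ℝ])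
  add_left := by
    cases b
    · exact InnerProductSpace.add_left (𝕜 := ℝ) (E := ℝ)
    · exact InnerProductSpace.add_left (𝕜 := ℝ) (E := ℂ)
    · exact InnerProductSpace.add_left (𝕜 := ℝ) (E := ℍ[ℝ])
  smul_left := by
    cases b
    · exact InnerProductSpace.smul_left (𝕜 := ℝ) (E := ℝ)
    · exact InnerProductSpace.smul_left (𝕜 := ℝ) (E := ℂ)
    · exact InnerProductSpace.smul_left (𝕜 := ℝ) (E := ℍ[ℝ])

instance (b : EntryKind) : FiniteDimensional ℝ b.Entry := by
  cases b
  · exact inferInstanceAs (FiniteDimensional ℝ ℝ)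
  · exact inferInstanceAs (FiniteDimensional ℝ ℂ)
  · exact inferInstanceAs (FiniteDimensional ℝ ℍ[ℝ])

/-- The Borel σ-algebra. -/
noncomputable instance (b : EntryKind) : MeasurableSpace b.Entry := borel b.Entry

instance (b : EntryKind) : BorelSpace b.Entry := ⟨rfl⟩

/-- Lebesgue measure on `𝔽_β` in the `β` real coordinates of an entry. -/
noncomputable def lebesgueEntry (b : EntryKind) : Measure b.Entry :=
  match b with
  | real => (volume : Measure ℝ)
  | complex => (volume : Measure ℂ)
  | quaternion => (volume : Measure (Fin 4 → ℝ)).map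
      (fun x => (⟨x 0, x 1, x 2, x 3⟩ : ℍ[ℝ]) : (Fin 4 → ℝ) → Entry quaternion)

theorem inner_mul_left (b : EntryKind) (x y z : b.Entry) :
    inner ℝ (x * y) z = inner ℝ y (star x * z) := by
  have h1 : ∀ x y z : ℝ, inner ℝ (x * y) z = inner ℝ y (star x * z) := by
    intro x y z
    simp
    ring
  have h2 : ∀ x y z : ℂ, inner ℝ (x * y) z = inner ℝ y (star x * z) := by
    intro x y z
    simp [Complex.inner]
    ring
  have h3 : ∀ x y z : ℍ[ℝ], inner ℝ (x * y) z = inner ℝ y (star x * z) := by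
    intro x y z
    simp [Quaternion.inner_def]
    ring
  cases b
  · exact h1 x y z
  · exact h2 x y z
  · exact h3 x y z

theorem eq_algebraMap_of_star_eq (b : EntryKind) (x : b.Entry) (h : star x = x) :
    ∃ r : ℝ, x = algebraMap ℝ b.Entry r := by
  cases b
  · exact ⟨x, rfl⟩
  · exact ⟨(x : ℂ).re, (Complex.conj_eq_iff_re.1 h).symm⟩
  · exact ⟨(x : ℍ[ℝ]).re, Quaternion.star_eq_self.1 h⟩

noncomputable instance {b : EntryKind} {n N : ℕ} : MeasurableSpace (Matrix (Fin n) (Fin N) b.Entry) :=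
  inferInstanceAs (MeasurableSpace (Fin n → Fin N → b.Entry))

/-- `(dM)`: Lebesgue measure on `n × N` matrices in the `β n N` real coordinates of the entries. -/
noncomputable def lebesgue (b : EntryKind) (n N : ℕ) :
    Measure (Matrix (Fin n) (Fin N) b.Entry) :=
  (Measure.pi fun _ : Fin n => Measure.pi fun _ : Fin N => b.lebesgueEntry).map Matrix.of

/-- The unitary group of `N × N` matrices over `𝔽_β`: `O(N)`, `U(N)` or the compact `Sp`. -/
noncomputable abbrev UnitaryGroup (b : EntryKind) (N : ℕ) := unitary (Matrix (Fin N) (Fin N) b.Entry)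

/-- Positive semidefinite Hermitian matrices over `𝔽_β`. -/
def IsPosSemidef {b : EntryKind} {N : ℕ} (W : Matrix (Fin N) (Fin N) b.Entry) : Prop :=
  W.IsHermitian ∧ ∀ x : Fin N → b.Entry,
    ∃ r : ℝ, 0 ≤ r ∧ star x ⬝ᵥ (W *ᵥ x) = algebraMap ℝ b.Entry r

open scoped Classical in
/-- The positive semidefinite square root `W^{1/2}` of a positive semidefinite matrix `W`
(see `sqrt_spec` and `sqrt_unique`), and `0` for other `W`. -/
noncomputable def sqrt {b : EntryKind} {N : ℕ} (W : Matrix (Fin N) (Fin N) b.Entry) :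
    Matrix (Fin N) (Fin N) b.Entry :=
  if h : ∃ H : Matrix (Fin N) (Fin N) b.Entry, IsPosSemidef H ∧ H * H = W then h.choose else 0

section Sqrt

/-- Left multiplication of column vectors by a matrix, as a real linear map. -/
noncomputable def leftMul (b : EntryKind) (N : ℕ) :
    Matrix (Fin N) (Fin N) b.Entry →ₐ[ℝ] Module.End ℝ (PiLp 2 fun _ : Fin N => b.Entry) where
  toFun A :=
    { toFun := fun x => WithLp.toLp 2 (A *ᵥ WithLp.ofLp x)
      map_add' := fun x y => by simp [Matrix.mulVec_add]
      map_smul' := fun r x => by simp [Matrix.mulVec_smul] }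
  map_one' := by ext; simp
  map_mul' A B := by ext; simp
  map_zero' := by ext; simp
  map_add' A B := by ext; simp [Matrix.add_mulVec]
  commutes' r := by
    ext x i
    simp [Algebra.algebraMap_eq_smul_one, Matrix.smul_mulVec]

theorem leftMul_injective (b : EntryKind) (N : ℕ) : Function.Injective (leftMul b N) := by
  intro A B h
  ext i j
  have := congrArg (fun T => (WithLp.ofLp (T (WithLp.toLp 2 (Pi.single j 1)))) i) h
  simpa [leftMul] using this

variable {b : EntryKind} {N : ℕ}

theorem inner_leftMul (A : Matrix (Fin N) (Fin N) b.Entry) (x y : PiLp 2 fun _ : Fin N => b.Entry) :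
    inner ℝ (leftMul b N A x) y = inner ℝ x (leftMul b N Aᴴ y) := by
  simp only [leftMul, PiLp.inner_apply, AlgHom.coe_mk, RingHom.coe_mk, MonoidHom.coe_mk,
    OneHom.coe_mk, LinearMap.coe_mk, AddHom.coe_mk, Matrix.mulVec, dotProduct, sum_inner, inner_sum,
    Matrix.conjTranspose_apply, inner_mul_left]
  exact Finset.sum_comm

theorem isSymmetric_leftMul_iff (A : Matrix (Fin N) (Fin N) b.Entry) :
    (leftMul b N A).IsSymmetric ↔ A.IsHermitian := by
  constructor
  · intro h
    apply leftMul_injective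
    ext1 y
    refine ext_inner_left ℝ fun x => ?_
    rw [← inner_leftMul, h]
  · intro h x y
    rw [inner_leftMul, h.eq]

theorem inner_leftMul_eq (A : Matrix (Fin N) (Fin N) b.Entry)
    (x : PiLp 2 fun _ : Fin N => b.Entry) :
    inner ℝ x (leftMul b N A x) =
      inner ℝ (1 : b.Entry) (star (WithLp.ofLp x) ⬝ᵥ (A *ᵥ WithLp.ofLp x)) := by
  simp only [dotProduct, inner_sum, PiLp.inner_apply, Pi.star_apply]
  refine Finset.sum_congr rfl fun i _ => ?_
  rw [← inner_mul_left, mul_one]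
  rfl

theorem inner_one_algebraMap (r : ℝ) : inner ℝ (1 : b.Entry) (algebraMap ℝ b.Entry r) = r := by
  rw [Algebra.algebraMap_eq_smul_one, inner_smul_right, real_inner_self_eq_norm_sq, norm_one]
  simp

theorem isPosSemidef_iff (A : Matrix (Fin N) (Fin N) b.Entry) :
    IsPosSemidef A ↔ (leftMul b N A).IsPositive := by
  rw [LinearMap.isPositive_iff]
  simp only [IsPosSemidef, isSymmetric_leftMul_iff]
  refine and_congr_right fun hA => ⟨fun h x => ?_, fun h x => ?_⟩
  · obtain ⟨r, hr, hx⟩ := h (WithLp.ofLp x)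
    rw [real_inner_comm, inner_leftMul_eq, hx, inner_one_algebraMap]
    exact hr
  · obtain ⟨r, hr⟩ := eq_algebraMap_of_star_eq b (star x ⬝ᵥ (A *ᵥ x)) (by
      rw [← Matrix.star_dotProduct_star, Matrix.star_mulVec, hA.eq, star_star,
        ← Matrix.dotProduct_mulVec])
    refine ⟨r, ?_, hr⟩
    have := h (WithLp.toLp 2 x)
    rwa [real_inner_comm, inner_leftMul_eq, hr, inner_one_algebraMap] at this

theorem aeval_of_apply_eq {V : Type*} [AddCommGroup V] [Module ℝ V] (T : Module.End ℝ V) {v : V}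
    {a : ℝ} (h : T v = a • v) (p : Polynomial ℝ) : Polynomial.aeval T p v = p.eval a • v := by
  by_cases hv : v = 0
  · simp [hv]
  · exact Module.End.aeval_apply_of_hasEigenvector
      (Module.End.hasEigenvector_iff.2 ⟨Module.End.mem_eigenspace_iff.2 h, hv⟩)

/-- A real polynomial that takes every eigenvalue of `W` to its square root. -/
theorem exists_poly (W : Matrix (Fin N) (Fin N) b.Entry) :
    ∃ p : Polynomial ℝ, ∀ a, (leftMul b N W).HasEigenvalue a → p.eval a = Real.sqrt a := by
  have hf : {a | (leftMul b N W).HasEigenvalue a}.Finite := Module.End.finite_hasEigenvalue _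
  refine ⟨Lagrange.interpolate hf.toFinset id Real.sqrt, fun a ha => ?_⟩
  exact Lagrange.eval_interpolate_at_node (v := id) Real.sqrt (Set.injOn_id _)
    (hf.mem_toFinset.2 ha)

theorem eq_aeval {W H : Matrix (Fin N) (Fin N) b.Entry} (hH : IsPosSemidef H) (hW : H * H = W)
    {p : Polynomial ℝ} (hp : ∀ a, (leftMul b N W).HasEigenvalue a → p.eval a = Real.sqrt a) :
    H = Polynomial.aeval W p := by
  have hpos := (isPosSemidef_iff H).1 hH
  apply leftMul_injective
  rw [← Polynomial.aeval_algHom_apply]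
  refine (hpos.isSymmetric.eigenvectorBasis rfl).toBasis.ext fun i => ?_
  set e := (hpos.isSymmetric.eigenvectorBasis rfl).toBasis i with he
  have h1 := hpos.isSymmetric.apply_eigenvectorBasis rfl i
  have h0 := hpos.nonneg_eigenvalues rfl i
  have hev := hpos.isSymmetric.hasEigenvector_eigenvectorBasis rfl i
  rw [OrthonormalBasis.coe_toBasis] at he
  rw [← he] at h1 hev
  set a : ℝ := hpos.isSymmetric.eigenvalues rfl i
  have h2 : leftMul b N W e = (a * a) • e := by
    rw [← hW, map_mul, Module.End.mul_apply, h1, map_smul]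
    rw [h1, smul_smul]; rfl
  rw [aeval_of_apply_eq _ h2, hp _ (Module.End.hasEigenvalue_of_hasEigenvector
    (Module.End.hasEigenvector_iff.2 ⟨Module.End.mem_eigenspace_iff.2 h2, hev.2⟩)),
    Real.sqrt_mul_self h0, h1]
  rfl

theorem aeval_spec {W : Matrix (Fin N) (Fin N) b.Entry} (hW : IsPosSemidef W)
    {p : Polynomial ℝ} (hp : ∀ a, (leftMul b N W).HasEigenvalue a → p.eval a = Real.sqrt a) :
    IsPosSemidef (Polynomial.aeval W p) ∧ Polynomial.aeval W p * Polynomial.aeval W p = W := by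
  have hpos := (isPosSemidef_iff W).1 hW
  set B := hpos.isSymmetric.eigenvectorBasis rfl with hB
  have hT : ∀ i, leftMul b N (Polynomial.aeval W p) (B i) =
      Real.sqrt (hpos.isSymmetric.eigenvalues rfl i) • B i := by
    intro i
    rw [← Polynomial.aeval_algHom_apply,
      aeval_of_apply_eq _ (hpos.isSymmetric.apply_eigenvectorBasis rfl i),
      hp _ (hpos.isSymmetric.hasEigenvalue_eigenvalues rfl i)]
    rfl
  have hin : ∀ x y, inner ℝ x (leftMul b N (Polynomial.aeval W p) y) =
      ∑ i, Real.sqrt (hpos.isSymmetric.eigenvalues rfl i) * (inner ℝ (B i) y * inner ℝ x (B i)) := by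
    intro x y
    conv_lhs => rw [← B.sum_repr' y]
    rw [map_sum, inner_sum]
    refine Finset.sum_congr rfl fun i _ => ?_
    rw [map_smul, hT, inner_smul_right, inner_smul_right]
    ring
  constructor
  · rw [isPosSemidef_iff, LinearMap.isPositive_iff]
    refine ⟨fun x y => ?_, fun x => ?_⟩
    · rw [real_inner_comm, hin, hin]
      refine Finset.sum_congr rfl fun i _ => ?_
      rw [real_inner_comm x, real_inner_comm (B i) y]
      ring
    · rw [real_inner_comm, hin]
      refine Finset.sum_nonneg fun i _ => mul_nonneg (Real.sqrt_nonneg _) ?_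
      rw [real_inner_comm]
      exact mul_self_nonneg _
  · apply leftMul_injective
    refine B.toBasis.ext fun i => ?_
    have h1 := hpos.isSymmetric.apply_eigenvectorBasis rfl i
    rw [OrthonormalBasis.coe_toBasis, map_mul, Module.End.mul_apply, hT, map_smul, hT, smul_smul,
      Real.mul_self_sqrt (hpos.nonneg_eigenvalues rfl i), hB, h1]
    rfl

theorem sqrt_spec {W : Matrix (Fin N) (Fin N) b.Entry} (hW : IsPosSemidef W) :
    IsPosSemidef (sqrt W) ∧ sqrt W * sqrt W = W := by
  obtain ⟨p, hp⟩ := exists_poly W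
  have h : ∃ H : Matrix (Fin N) (Fin N) b.Entry, IsPosSemidef H ∧ H * H = W :=
    ⟨_, aeval_spec hW hp⟩
  rw [sqrt, dif_pos h]
  exact h.choose_spec

theorem sqrt_unique {W H : Matrix (Fin N) (Fin N) b.Entry} (hH : IsPosSemidef H)
    (hW : H * H = W) : H = sqrt W := by
  obtain ⟨p, hp⟩ := exists_poly W
  have h : ∃ H : Matrix (Fin N) (Fin N) b.Entry, IsPosSemidef H ∧ H * H = W := ⟨H, hH, hW⟩
  rw [sqrt, dif_pos h, eq_aeval hH hW hp]
  exact (eq_aeval h.choose_spec.1 h.choose_spec.2 hp).symm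

theorem isPosSemidef_conjTranspose_mul_self {n : ℕ} (A : Matrix (Fin n) (Fin N) b.Entry) :
    IsPosSemidef (Aᴴ * A) := by
  refine ⟨Matrix.isHermitian_conjTranspose_mul_self A, fun x => ?_⟩
  have h : ∀ i, ∃ r : ℝ, 0 ≤ r ∧ star ((A *ᵥ x) i) * (A *ᵥ x) i = algebraMap ℝ b.Entry r := by
    intro i
    obtain ⟨r, hr⟩ := eq_algebraMap_of_star_eq b (star ((A *ᵥ x) i) * (A *ᵥ x) i) (by simp)
    refine ⟨r, ?_, hr⟩
    rw [← inner_one_algebraMap (b := b) r, ← hr, ← inner_mul_left, mul_one]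
    exact real_inner_self_nonneg
  choose r hr0 hr using h
  refine ⟨∑ i, r i, Finset.sum_nonneg fun i _ => hr0 i, ?_⟩
  rw [← Matrix.mulVec_mulVec, Matrix.dotProduct_mulVec, ← Matrix.star_mulVec, map_sum]
  exact Finset.sum_congr rfl fun i _ => hr i

end Sqrt

/-- The complex representation of a quaternion matrix: the entry `z + w j` with `z, w ∈ ℂ` becomes
the block `[z, w; -conj w, conj z]`. -/
def complexRep {n N : ℕ} (A : Matrix (Fin n) (Fin N) ℍ[ℝ]) :
    Matrix (Fin n × Fin 2) (Fin N × Fin 2) ℂ :=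
  Matrix.of fun p q =>
    (!![⟨(A p.1 q.1).re, (A p.1 q.1).imI⟩, ⟨(A p.1 q.1).imJ, (A p.1 q.1).imK⟩;
        -star ⟨(A p.1 q.1).imJ, (A p.1 q.1).imK⟩, star ⟨(A p.1 q.1).re, (A p.1 q.1).imI⟩] :
      Matrix (Fin 2) (Fin 2) ℂ) p.2 q.2

/-- The determinant of a positive semidefinite matrix `W` over `𝔽_β`, the product of its `N`
eigenvalues. In the quaternion case each of them is a double eigenvalue of the complex
representation of `W`, and is counted once. -/
noncomputable def hermDet {N : ℕ} :
    (b : EntryKind) → Matrix (Fin N) (Fin N) b.Entry → ℝ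
  | real, W => Matrix.det (R := ℝ) (n := Fin N) W
  | complex, W => (Matrix.det (R := ℂ) (n := Fin N) W).re
  | quaternion, W => Real.sqrt (Matrix.det (complexRep W)).re

/-- The random `n × N` matrix `X` has probability density function `f` with respect to `(dM)`. -/
def HasDensity {b : EntryKind} {n N : ℕ} {Ω : Type*} [MeasurableSpace Ω]
    (X : Ω → Matrix (Fin n) (Fin N) b.Entry) (μ : Measure Ω)
    (f : Matrix (Fin n) (Fin N) b.Entry → ℝ) : Prop :=
  AEMeasurable X μ ∧ Measurable f ∧ (∀ A, 0 ≤ f A) ∧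
    μ.map X = (b.lebesgue n N).withDensity (fun A => ENNReal.ofReal (f A))

end EntryKind

/-- `σ_l = 2 π^{l/2} / Γ(l/2)`, the surface area of the unit sphere in `ℝ^l`. -/
noncomputable def sphereArea (l : ℝ) : ℝ := 2 * Real.pi ^ (l / 2) / Real.Gamma (l / 2)

/-! The proof computes the law of the Gram matrix for `n × N` matrices, then restores the unitary
factor.

Split off the first column `a` and rotate it onto the first axis by a unitary matrix. Left
invariance of Lebesgue measure absorbs that rotation into the other columns, so the Gram matrix
becomes that of a block triangular matrix with corner `r = ‖a‖`, a free row `v` and an `(n-1) ×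
(N-1)` block `B`. It depends on `B` only through `Bᴴ * B`. In polar coordinates `a` contributes
`σ_{βn} r^{βn-1} dr`, whereas an `N × N` matrix gives `σ_{βN} r^{βN-1} dr`. The quotient is a
sphere-area ratio times `r^{β(n-N)}`, and this power is what the corner contributes to
`det^{β(n-N)/2}`, since the determinant of the Gram matrix gains a factor `r²`. Induction on `N`
gives `lintegral_gram`; `lintegral_gram_succ` is the peeling step and `hermDet_borderTriangular` the
determinant step.

For the unitary factor, write a square `K` as `V * sqrt (Kᴴ * K)` (`exists_polar`). Right invariance
of Haar measure makes `U * sqrt (Kᴴ * K)` and `U * K` equal in law (`lintegral_unitary_mul_sqrt`).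
Averaging over `U` then changes nothing, because both Lebesgue measure and the density are invariant
under `K ↦ U * K` (`lintegral_unitary_average`). -/

namespace EntryKind

/-! ### Topology of matrix spaces and measurability of the square root. -/

section Topology

variable {b : EntryKind} {n N : ℕ}

instance (b : EntryKind) : SecondCountableTopology b.Entry :=
  secondCountable_of_proper (α := b.Entry)

instance : BorelSpace (Matrix (Fin n) (Fin N) b.Entry) :=
  inferInstanceAs (BorelSpace (Fin n → Fin N → b.Entry))

instance : SecondCountableTopology (Matrix (Fin n) (Fin N) b.Entry) :=
  inferInstanceAs (SecondCountableTopology (Fin n → Fin N → b.Entry))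

instance : PolishSpace (Matrix (Fin n) (Fin N) b.Entry) :=
  inferInstanceAs (PolishSpace (Fin n → Fin N → b.Entry))

instance : LocallyCompactSpace (Matrix (Fin n) (Fin N) b.Entry) :=
  inferInstanceAs (LocallyCompactSpace (Fin n → Fin N → b.Entry))

theorem norm_star_entry (x : b.Entry) : ‖star x‖ = ‖x‖ := by
  cases b
  · exact norm_star (E := ℝ) x
  · exact norm_star (E := ℂ) x
  · exact norm_star (E := ℍ[ℝ]) x

theorem star_mul_self_entry (x : b.Entry) : star x * x = algebraMap ℝ b.Entry (‖x‖ ^ 2) := by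
  obtain ⟨r, hr⟩ := eq_algebraMap_of_star_eq b (star x * x) (by simp)
  have h := congrArg (inner ℝ (1 : b.Entry)) hr
  rw [← inner_mul_left, mul_one, real_inner_self_eq_norm_sq, inner_one_algebraMap] at h
  rw [hr, h]

instance (b : EntryKind) : NormedStarGroup b.Entry := ⟨fun x => (norm_star_entry x).le⟩

theorem conjTranspose_mul_self_apply (A : Matrix (Fin n) (Fin N) b.Entry) (j : Fin N) :
    (Aᴴ * A) j j = algebraMap ℝ b.Entry (∑ i, ‖A i j‖ ^ 2) := by
  simp [Matrix.mul_apply, star_mul_self_entry]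

/-- For Hermitian `W` the quadratic form is automatically real, so positivity reduces to closed
inequalities on its real part. Closedness serves both the measurability of `sqrt` and the limit
argument in `exists_polar`. -/
theorem isClosed_isPosSemidef : IsClosed {W : Matrix (Fin N) (Fin N) b.Entry | IsPosSemidef W} := by
  have h : {W : Matrix (Fin N) (Fin N) b.Entry | IsPosSemidef W} =
      {W | Wᴴ = W} ∩ ⋂ x : Fin N → b.Entry, {W | 0 ≤ inner ℝ (1 : b.Entry) (star x ⬝ᵥ (W *ᵥ x))} := by
    ext W
    simp only [IsPosSemidef, Set.mem_ofPred_eq, Set.mem_inter_iff, Set.mem_iInter]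
    refine and_congr_right fun hW => forall_congr' fun x => ?_
    constructor
    · rintro ⟨r, hr, h⟩
      rwa [h, inner_one_algebraMap]
    · intro h
      obtain ⟨r, hr⟩ := eq_algebraMap_of_star_eq b (star x ⬝ᵥ (W *ᵥ x)) (by
        rw [← Matrix.star_dotProduct_star, Matrix.star_mulVec, hW, star_star,
          ← Matrix.dotProduct_mulVec])
      rw [hr, inner_one_algebraMap] at h
      exact ⟨r, h, hr⟩
  rw [h]
  refine (isClosed_eq (by fun_prop) continuous_id).inter (isClosed_iInter fun x => ?_)
  exact isClosed_le continuous_const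
    (continuous_const.inner (continuous_const.dotProduct (continuous_id.matrix_mulVec continuous_const)))

/-- Squaring is continuous and injective on the closed, hence Polish, set of positive semidefinite
matrices. By the Lusin–Souslin theorem it is a measurable embedding, so its inverse is measurable on
a measurable range; off that range `sqrt` takes its default value `0`. -/
theorem measurable_sqrt : Measurable (sqrt : Matrix (Fin N) (Fin N) b.Entry → _) := by
  let S : Set (Matrix (Fin N) (Fin N) b.Entry) := {W | IsPosSemidef W}
  have hS : MeasurableSet S := isClosed_isPosSemidef.measurableSet
  have : PolishSpace S := isClosed_isPosSemidef.polishSpace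
  let f : S → Matrix (Fin N) (Fin N) b.Entry := fun H => H.1 * H.1
  have hf : MeasurableEmbedding f := by
    refine Continuous.measurableEmbedding (by fun_prop) fun H K h => Subtype.ext ?_
    rw [sqrt_unique H.2 rfl, sqrt_unique K.2 rfl]
    exact congrArg sqrt h
  refine measurable_of_restrict_of_restrict_compl (s := Set.range f) hf.measurableSet_range ?_ ?_
  · have h : (Set.range f).domRestrict sqrt = fun W => ((hf.equivRange).symm W : Matrix _ _ _) := by
      funext W
      obtain ⟨H, rfl⟩ := (hf.equivRange).surjective W
      rw [MeasurableEquiv.symm_apply_apply]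
      rw [Set.domRestrict_apply, hf.equivRange_apply]
      exact (sqrt_unique H.2 rfl).symm
    rw [h]
    exact measurable_subtype_coe.comp (hf.equivRange).symm.measurable
  · have h : (Set.range f)ᶜ.domRestrict sqrt = fun _ => (0 : Matrix (Fin N) (Fin N) b.Entry) := by
      funext W
      rw [Set.domRestrict_apply, sqrt, dif_neg]
      rintro ⟨H, hH, hW⟩
      exact W.2 ⟨⟨H, hH⟩, hW⟩
    rw [h]
    exact measurable_const

end Topology

/-! ### The compact unitary group and polar decomposition. -/

section Unitary

variable {b : EntryKind} {n N : ℕ}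

theorem norm_le_one_of_unitary (U : b.UnitaryGroup N) (i j : Fin N) : ‖U.1 i j‖ ≤ 1 := by
  have h : (U.1ᴴ * U.1) j j = 1 := by
    have := Unitary.star_mul_self_of_mem U.2
    rw [Matrix.star_eq_conjTranspose] at this
    simp [this]
  rw [conjTranspose_mul_self_apply, ← map_one (algebraMap ℝ b.Entry),
    (algebraMap ℝ b.Entry).injective.eq_iff] at h
  have h2 := Finset.single_le_sum (f := fun i => ‖U.1 i j‖ ^ 2) (fun i _ => sq_nonneg _)
    (Finset.mem_univ i)
  rw [h] at h2
  exact (sq_le_one_iff₀ (norm_nonneg _)).1 h2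

theorem isClosed_unitary :
    IsClosed (unitary (Matrix (Fin N) (Fin N) b.Entry) : Set (Matrix (Fin N) (Fin N) b.Entry)) := by
  have : (unitary (Matrix (Fin N) (Fin N) b.Entry) : Set (Matrix (Fin N) (Fin N) b.Entry)) =
      {A | Aᴴ * A = 1} ∩ {A | A * Aᴴ = 1} := by
    ext A
    simp [Unitary.mem_iff, Matrix.star_eq_conjTranspose]
  rw [this]
  exact (isClosed_eq (by fun_prop) continuous_const).inter
    (isClosed_eq (by fun_prop) continuous_const)

instance : SecondCountableTopology (b.UnitaryGroup N) :=
  TopologicalSpace.Subtype.secondCountableTopology _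

instance : BorelSpace (b.UnitaryGroup N) := Subtype.borelSpace _

instance : IsTopologicalGroup (b.UnitaryGroup N) where
  continuous_mul := continuous_mul
  continuous_inv := by
    refine Continuous.subtype_mk ?_ _
    exact (continuous_subtype_val (p := (· ∈ unitary (Matrix (Fin N) (Fin N) b.Entry)))).star

instance : CompactSpace (b.UnitaryGroup N) := by
  refine isCompact_iff_compactSpace.1 ?_
  have hK : IsCompact (Set.univ.pi fun _ : Fin N => Set.univ.pi fun _ : Fin N =>
      Metric.closedBall (0 : b.Entry) 1) :=
    isCompact_univ_pi fun _ => isCompact_univ_pi fun _ => isCompact_closedBall _ _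
  refine IsCompact.of_isClosed_subset (X := Matrix (Fin N) (Fin N) b.Entry) hK isClosed_unitary ?_
  intro U hU i _ j _
  simpa using norm_le_one_of_unitary ⟨U, hU⟩ i j

/-- With `L = K⁻¹` and `H² = Kᴴ * K`, the unitary factor `K * H⁻¹` can be written `Lᴴ * H`, which
avoids inverting `H`. -/
theorem exists_polar_of_isUnit {K : Matrix (Fin N) (Fin N) b.Entry} (hK : IsUnit K) :
    ∃ V : b.UnitaryGroup N, K = V.1 * sqrt (Kᴴ * K) := by
  obtain ⟨hH, hHH⟩ := sqrt_spec (isPosSemidef_conjTranspose_mul_self K)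
  set H := sqrt (Kᴴ * K)
  obtain ⟨L, hKL, hLK⟩ := isUnit_iff_exists.1 hK
  have hKL' : Lᴴ * Kᴴ = 1 := by rw [← Matrix.conjTranspose_mul, hKL, Matrix.conjTranspose_one]
  have hLK' : Kᴴ * Lᴴ = 1 := by rw [← Matrix.conjTranspose_mul, hLK, Matrix.conjTranspose_one]
  have h1 : H * (H * L * Lᴴ) = 1 := by
    simp only [← Matrix.mul_assoc, hHH]
    rw [Matrix.mul_assoc Kᴴ, hKL, Matrix.mul_one, hLK']
  have h2 : (L * Lᴴ * H) * H = 1 := by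
    rw [Matrix.mul_assoc, hHH, Matrix.mul_assoc, ← Matrix.mul_assoc Lᴴ, hKL', Matrix.one_mul, hLK]
  -- The right and left inverses of `H` coincide; this is what makes `Lᴴ * H` an isometry.
  have h3 : H * L * Lᴴ = L * Lᴴ * H := (left_inv_eq_right_inv h2 h1).symm
  have hHs : Hᴴ = H := hH.1
  refine ⟨⟨Lᴴ * H, ?_⟩, ?_⟩
  · rw [Unitary.mem_iff, Matrix.star_eq_conjTranspose, Matrix.conjTranspose_mul,
      Matrix.conjTranspose_conjTranspose, hHs]
    refine ⟨?_, ?_⟩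
    · rw [← Matrix.mul_assoc, h3, h2]
    · rw [Matrix.mul_assoc, ← Matrix.mul_assoc H H, hHH, Matrix.mul_assoc Kᴴ, hKL, Matrix.mul_one,
        hKL']
  · rw [Matrix.mul_assoc, hHH, ← Matrix.mul_assoc, hKL', Matrix.one_mul]

/-- Only finitely many real `t` are eigenvalues of `-K` acting on columns as a real linear map; all
other `t` make `K + t` invertible, and they accumulate at `0`. The real spectrum replaces a
determinant, so that quaternions need no separate treatment. -/
theorem exists_tendsto_zero_isUnit_add_smul_one (K : Matrix (Fin N) (Fin N) b.Entry) :
    ∃ t : ℕ → ℝ, Filter.Tendsto t Filter.atTop (nhds 0) ∧ ∀ k, IsUnit (K + t k • 1) := by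
  have hfin : {a | (leftMul b N (-K)).HasEigenvalue a}.Finite := Module.End.finite_hasEigenvalue _
  have hd : Dense {a | (leftMul b N (-K)).HasEigenvalue a}ᶜ := hfin.countable.dense_compl ℝ
  obtain ⟨t, ht, htl⟩ := mem_closure_iff_seq_limit.1 (hd.closure_eq ▸ Set.mem_univ (0 : ℝ))
  refine ⟨t, htl, fun k => ?_⟩
  have h := ht k
  rw [Set.mem_compl_iff, Set.mem_ofPred_eq, Module.End.hasEigenvalue_iff_mem_spectrum,
    spectrum.mem_iff, not_not] at h
  have h1 : algebraMap ℝ (Module.End ℝ (PiLp 2 fun _ : Fin N => b.Entry)) (t k) - leftMul b N (-K) =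
      leftMul b N (K + t k • 1) := by
    rw [map_neg, map_add, map_smul, map_one, Algebra.algebraMap_eq_smul_one]
    abel
  rw [h1] at h
  -- left multiplication is injective, and an injective `ℝ`-algebra endomorphism is invertible
  have hreg : Function.Injective fun X : Matrix (Fin N) (Fin N) b.Entry => (K + t k • 1) * X := by
    intro X Y hXY
    apply leftMul_injective
    have := congrArg (leftMul b N) hXY
    simp only [map_mul] at this
    exact h.mul_left_cancel this
  have hsurj := (LinearMap.injective_iff_surjective
    (f := LinearMap.mulLeft ℝ (K + t k • (1 : Matrix (Fin N) (Fin N) b.Entry)))).1 hreg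
  obtain ⟨L, hL⟩ := hsurj 1
  refine isUnit_iff_exists.2 ⟨L, hL, ?_⟩
  apply hreg
  change (K + t k • 1) * L = 1 at hL
  simp only
  rw [← Matrix.mul_assoc, hL, Matrix.one_mul, Matrix.mul_one]

/-- Polar decomposition. -/
theorem exists_polar (K : Matrix (Fin N) (Fin N) b.Entry) :
    ∃ V : b.UnitaryGroup N, K = V.1 * sqrt (Kᴴ * K) := by
  obtain ⟨t, ht, hu⟩ := exists_tendsto_zero_isUnit_add_smul_one K
  choose V hV using fun k => exists_polar_of_isUnit (hu k)
  -- Unitary factors of invertible perturbations of `K` have a convergent subsequence by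
  -- compactness.
  obtain ⟨V₀, φ, hφ, hlim⟩ := CompactSpace.tendsto_subseq V
  refine ⟨V₀, ?_⟩
  have hVl : Filter.Tendsto (fun k => (V (φ k)).1) Filter.atTop (nhds V₀.1) :=
    (continuous_subtype_val.tendsto _).comp hlim
  have hKl : Filter.Tendsto (fun k => K + t (φ k) • (1 : Matrix (Fin N) (Fin N) b.Entry))
      Filter.atTop (nhds K) := by
    have := ((ht.comp hφ.tendsto_atTop).smul_const (1 : Matrix (Fin N) (Fin N) b.Entry)).const_add K
    simpa using this
  have hs : ∀ U : b.UnitaryGroup N, U.1ᴴ * U.1 = 1 := fun U => Unitary.star_mul_self_of_mem U.2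
  have hs' : ∀ U : b.UnitaryGroup N, U.1 * U.1ᴴ = 1 := fun U => Unitary.mul_star_self_of_mem U.2
  have hH : ∀ k, (V k).1ᴴ * (K + t k • 1) = sqrt ((K + t k • 1)ᴴ * (K + t k • 1)) := by
    intro k
    conv_lhs => rw [hV k]
    rw [← Matrix.mul_assoc, hs, Matrix.one_mul]
  -- Continuity of `sqrt` is not needed: the limit `V₀ᴴ * K` is positive semidefinite by closedness
  -- and squares to `Kᴴ * K`, so uniqueness of the root identifies it.
  have hpos : IsPosSemidef (V₀.1ᴴ * K) := by
    refine isClosed_isPosSemidef.mem_of_tendsto (((continuous_id.matrix_conjTranspose.tendsto _).comp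
      hVl).mul hKl) (Filter.Eventually.of_forall fun k => ?_)
    simp only [Function.comp_apply, id, Set.mem_ofPred_eq]
    rw [hH]
    exact (sqrt_spec (isPosSemidef_conjTranspose_mul_self _)).1
  have hsq : (V₀.1ᴴ * K) * (V₀.1ᴴ * K) = Kᴴ * K := by
    have h : (V₀.1ᴴ * K)ᴴ = V₀.1ᴴ * K := hpos.1
    nth_rw 1 [← h]
    rw [Matrix.conjTranspose_mul, Matrix.conjTranspose_conjTranspose, Matrix.mul_assoc,
      ← Matrix.mul_assoc V₀.1, hs', Matrix.one_mul]
  rw [← sqrt_unique hpos hsq, ← Matrix.mul_assoc, hs', Matrix.one_mul]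

end Unitary

/-! ### Lebesgue measure: Gaussian normalisation and unitary invariance. -/

section Lebesgue

variable {b : EntryKind} {n N : ℕ}

theorem finrank_entry (b : EntryKind) : Module.finrank ℝ b.Entry = b.beta := by
  cases b
  · exact Module.finrank_self ℝ
  · exact Complex.finrank_real_complex
  · exact Quaternion.finrank_eq_four

/-- The real coordinates of a quaternion. -/
noncomputable def quaternionEquiv : (Fin 4 → ℝ) ≃L[ℝ] Entry quaternion :=
  let e : (Fin 4 → ℝ) ≃L[ℝ] ℍ[ℝ] := (EuclideanSpace.equiv (Fin 4) ℝ).symm.trans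
    Quaternion.linearIsometryEquivTuple.symm.toContinuousLinearEquiv
  e

theorem lebesgueEntry_quaternion :
    lebesgueEntry quaternion = (volume : Measure (Fin 4 → ℝ)).map quaternionEquiv := rfl

instance (b : EntryKind) : b.lebesgueEntry.IsAddHaarMeasure := by
  cases b
  · exact inferInstanceAs (volume : Measure ℝ).IsAddHaarMeasure
  · exact inferInstanceAs (volume : Measure ℂ).IsAddHaarMeasure
  · exact quaternionEquiv.isAddHaarMeasure_map volume

/-- This pins down the scale of `lebesgueEntry`, and through it the constants `σ_l`. For quaternions
the four coordinates are isometric to Euclidean space. -/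
theorem integral_gaussian_entry (b : EntryKind) :
    ∫ x, Real.exp (-‖x‖ ^ 2) ∂b.lebesgueEntry = Real.pi ^ ((b.beta : ℝ) / 2) := by
  have h1 : ∀ (V : Type) [NormedAddCommGroup V] [InnerProductSpace ℝ V] [FiniteDimensional ℝ V]
      [MeasurableSpace V] [BorelSpace V],
      ∫ v : V, Real.exp (-‖v‖ ^ 2) = Real.pi ^ ((Module.finrank ℝ V : ℝ) / 2) := by
    intro V _ _ _ _ _
    simpa using GaussianFourier.integral_rexp_neg_mul_sq_norm (V := V) one_pos
  cases b
  · have := h1 ℝ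
    rw [Module.finrank_self] at this
    exact this
  · have := h1 ℂ
    rw [Complex.finrank_real_complex] at this
    exact this
  · rw [lebesgueEntry_quaternion]
    have h2 := h1 (EuclideanSpace ℝ (Fin 4))
    rw [finrank_euclideanSpace_fin,
      ← (EuclideanSpace.volume_preserving_symm_measurableEquiv_toLp (Fin 4)).symm.integral_comp'] at h2
    refine (integral_map_equiv
      quaternionEquiv.toHomeomorph.toMeasurableEquiv _).trans ?_
    rw [show (beta quaternion : ℝ) = (4 : ℕ) from rfl, ← h2]
    refine integral_congr_ae (Filter.Eventually.of_forall fun x => ?_)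
    have h3 : ‖quaternionEquiv x‖ = ‖WithLp.toLp 2 x‖ :=
      Quaternion.linearIsometryEquivTuple.symm.norm_map (WithLp.toLp 2 x)
    exact congrArg (fun t => Real.exp (-t ^ 2)) h3

theorem lebesgue_eq_pi : b.lebesgue n N =
    (Measure.pi fun _ : Fin n => Measure.pi fun _ : Fin N => b.lebesgueEntry) :=
  Measure.map_id

instance : (b.lebesgue n N).IsAddHaarMeasure := by
  rw [lebesgue_eq_pi]
  exact Measure.pi.isAddHaarMeasure (α := fun _ : Fin n => Fin N → b.Entry)
    (fun _ : Fin n => Measure.pi fun _ : Fin N => b.lebesgueEntry)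

/-- Multiplication by a unitary matrix from the left. -/
noncomputable def unitaryMulEquiv (Q : b.UnitaryGroup n) :
    Matrix (Fin n) (Fin N) b.Entry ≃L[ℝ] Matrix (Fin n) (Fin N) b.Entry where
  toFun A := Q.1 * A
  invFun A := Q.1ᴴ * A
  map_add' A B := Matrix.mul_add _ _ _
  map_smul' r A := Matrix.mul_smul _ _ _
  left_inv A := by
    have h : Q.1ᴴ * Q.1 = 1 := Unitary.star_mul_self_of_mem Q.2
    simp only
    rw [← Matrix.mul_assoc, h, Matrix.one_mul]
  right_inv A := by
    have h : Q.1 * Q.1ᴴ = 1 := Unitary.mul_star_self_of_mem Q.2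
    simp only
    rw [← Matrix.mul_assoc, h, Matrix.one_mul]
  continuous_toFun := by fun_prop
  continuous_invFun := by fun_prop

theorem conjTranspose_mul_self_unitary_mul (Q : b.UnitaryGroup n)
    (A : Matrix (Fin n) (Fin N) b.Entry) : (Q.1 * A)ᴴ * (Q.1 * A) = Aᴴ * A := by
  have h : Q.1ᴴ * Q.1 = 1 := Unitary.star_mul_self_of_mem Q.2
  rw [Matrix.conjTranspose_mul, Matrix.mul_assoc, ← Matrix.mul_assoc _ Q.1, h, Matrix.one_mul]

/-- Lebesgue measure is invariant under unitary matrices acting from the left. -/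
theorem measurePreserving_unitary_mul (Q : b.UnitaryGroup n) :
    MeasurePreserving (fun A : Matrix (Fin n) (Fin N) b.Entry => Q.1 * A)
      (b.lebesgue n N) (b.lebesgue n N) := by
  refine ⟨(unitaryMulEquiv Q).continuous.measurable, ?_⟩
  change (b.lebesgue n N).map (unitaryMulEquiv Q) = _
  have := (unitaryMulEquiv (N := N) Q).isAddHaarMeasure_map (b.lebesgue n N)
  have h := Measure.isAddLeftInvariant_eq_smul
    ((b.lebesgue n N).map (unitaryMulEquiv Q)) (b.lebesgue n N)
  set c := Measure.addHaarScalarFactor ((b.lebesgue n N).map (unitaryMulEquiv Q)) (b.lebesgue n N)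
  -- The pushforward is a multiple `c` of Lebesgue measure. The set `S` is open and bounded, and it
  -- is invariant because it is cut out by the diagonal of the Gram matrix; comparing its two
  -- measures forces `c = 1`.
  let S : Set (Matrix (Fin n) (Fin N) b.Entry) := {A | ∀ j, ∑ i, ‖A i j‖ ^ 2 < 1}
  have hSo : IsOpen S := by
    have : S = ⋂ j, {A | ∑ i, ‖A i j‖ ^ 2 < 1} := by ext; simp [S]
    rw [this]
    exact isOpen_iInter_of_finite fun j => isOpen_lt (by fun_prop) continuous_const
  have hS0 : b.lebesgue n N S ≠ 0 := (hSo.measure_pos _ ⟨0, by simp [S]⟩).ne'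
  have hSt : b.lebesgue n N S ≠ ⊤ := by
    have hK : IsCompact (X := Matrix (Fin n) (Fin N) b.Entry)
        (Set.univ.pi fun _ : Fin n => Set.univ.pi fun _ : Fin N =>
        Metric.closedBall (0 : b.Entry) 1) :=
      isCompact_univ_pi fun _ => isCompact_univ_pi fun _ => isCompact_closedBall _ _
    refine ((measure_mono ?_).trans_lt hK.measure_lt_top).ne
    intro A hA i _ j _
    have h2 := Finset.single_le_sum (f := fun i => ‖A i j‖ ^ 2) (fun i _ => sq_nonneg _)
      (Finset.mem_univ i)
    simpa using (sq_le_one_iff₀ (norm_nonneg _)).1 (h2.trans (hA j).le)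
  have hpre : (unitaryMulEquiv (N := N) Q) ⁻¹' S = S := by
    ext A
    refine forall_congr' fun j => ?_
    have h := congrFun (congrFun (conjTranspose_mul_self_unitary_mul Q A) j) j
    rw [conjTranspose_mul_self_apply, conjTranspose_mul_self_apply,
      (algebraMap ℝ b.Entry).injective.eq_iff] at h
    rw [← h]
    rfl
  have hc := congrArg (fun μ => μ S) h
  simp only [Measure.smul_apply] at hc
  rw [Measure.map_apply (unitaryMulEquiv (N := N) Q).continuous.measurable hSo.measurableSet,
    hpre] at hc
  have hc1 : (c : ENNReal) = 1 := by
    have : (c : ENNReal) * b.lebesgue n N S = 1 * b.lebesgue n N S := by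
      rw [one_mul]; exact hc.symm
    exact (ENNReal.mul_left_inj hS0 hSt).1 this
  rw [h, ENNReal.coe_eq_one.1 hc1, one_smul]

end Lebesgue

/-! ### Polar coordinates for column vectors. -/

section Radial

/-- Away from the null point `0` the measure is a product of a sphere measure and `r^{d-1} dr`, and
the sphere has total mass `d` times the measure of the unit ball. -/
theorem lintegral_fun_norm_addHaar {E : Type*} [NormedAddCommGroup E] [NormedSpace ℝ E]
    [Nontrivial E] [MeasurableSpace E] [BorelSpace E] [FiniteDimensional ℝ E] (μ : Measure E)
    [μ.IsAddHaarMeasure] {f : ℝ → ENNReal} (hf : Measurable f) :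
    ∫⁻ x, f ‖x‖ ∂μ = Module.finrank ℝ E * μ (Metric.ball 0 1) *
      ∫⁻ r in Set.Ioi (0 : ℝ), ENNReal.ofReal (r ^ (Module.finrank ℝ E - 1)) * f r := by
  calc
    ∫⁻ x, f ‖x‖ ∂μ = ∫⁻ x : ({(0)}ᶜ : Set E), f ‖x.1‖ ∂(μ.comap (↑)) := by
      rw [lintegral_subtype_comap (measurableSet_singleton _).compl fun x ↦ f (‖x‖),
        restrict_compl_singleton]
    _ = ∫⁻ x, f x.2 ∂μ.toSphere.prod (.volumeIoiPow (Module.finrank ℝ E - 1)) := by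
      simpa using μ.measurePreserving_homeomorphUnitSphereProd.lintegral_comp_emb
        (Homeomorph.measurableEmbedding _) (fun x => f x.2)
    _ = μ.toSphere Set.univ *
        ∫⁻ x : Set.Ioi (0 : ℝ), f x ∂.volumeIoiPow (Module.finrank ℝ E - 1) := by
      rw [lintegral_prod _ (by fun_prop)]
      simp only [lintegral_const]
      rw [mul_comm]
    _ = _ := by
      rw [Measure.toSphere_apply_univ, Measure.volumeIoiPow, lintegral_withDensity_eq_lintegral_mul
        _ (by fun_prop) (by fun_prop), ← lintegral_subtype_comap measurableSet_Ioi]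
      rfl

variable {b : EntryKind}

/-- The Euclidean norm of a column vector. -/
noncomputable def vecNorm {n : ℕ} (a : Fin n → b.Entry) : ℝ := ‖WithLp.toLp 2 a‖

theorem vecNorm_sq {n : ℕ} (a : Fin n → b.Entry) : vecNorm a ^ 2 = ∑ i, ‖a i‖ ^ 2 := by
  rw [vecNorm, PiLp.norm_sq_eq_of_L2]

theorem beta_pos (b : EntryKind) : 0 < b.beta := by cases b <;> decide

/-- Integration in polar coordinates. -/
theorem lintegral_vecNorm (n : ℕ) {f : ℝ → ENNReal} (hf : Measurable f) :
    ∫⁻ a, f (vecNorm a) ∂(Measure.pi fun _ : Fin (n + 1) => b.lebesgueEntry) =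
      ENNReal.ofReal (sphereArea (b.beta * (n + 1 : ℕ))) *
        ∫⁻ r in Set.Ioi (0 : ℝ), ENNReal.ofReal (r ^ (b.beta * (n + 1) - 1)) * f r := by
  let e : (Fin (n + 1) → b.Entry) ≃L[ℝ] PiLp 2 fun _ : Fin (n + 1) => b.Entry :=
    (PiLp.continuousLinearEquiv 2 ℝ fun _ : Fin (n + 1) => b.Entry).symm
  let μ := (Measure.pi fun _ : Fin (n + 1) => b.lebesgueEntry).map e
  have : μ.IsAddHaarMeasure := e.isAddHaarMeasure_map _
  have hd : Module.finrank ℝ (PiLp 2 fun _ : Fin (n + 1) => b.Entry) = b.beta * (n + 1) := by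
    rw [← e.toLinearEquiv.finrank_eq, Module.finrank_pi_fintype]
    simp [finrank_entry, mul_comm]
  have h := lintegral_fun_norm_addHaar μ hf
  rw [hd, lintegral_map (by fun_prop) e.continuous.measurable] at h
  have hl : ∫⁻ a, f (vecNorm a) ∂(Measure.pi fun _ : Fin (n + 1) => b.lebesgueEntry) =
    ∫⁻ a, f ‖e a‖ ∂(Measure.pi fun _ : Fin (n + 1) => b.lebesgueEntry) := rfl
  rw [hl, h]
  congr 1
  -- The Gaussian integral factors over the entries and determines the measure of the unit ball for
  -- this particular Haar measure.
  have hg : ∫ x, Real.exp (-‖x‖ ^ (2 : ℝ)) ∂μ = Real.pi ^ ((b.beta * (n + 1 : ℕ) : ℝ) / 2) := by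
    refine (integral_map_equiv e.toHomeomorph.toMeasurableEquiv _).trans ?_
    have h2 : ∀ a : Fin (n + 1) → b.Entry, Real.exp (-‖e a‖ ^ (2 : ℝ)) =
        ∏ i, Real.exp (-‖a i‖ ^ 2) := by
      intro a
      rw [← Real.exp_sum, Finset.sum_neg_distrib, ← vecNorm_sq, Real.rpow_two]
      rfl
    refine (integral_congr_ae (Filter.Eventually.of_forall h2)).trans ?_
    rw [integral_fintype_prod_eq_pow (E := b.Entry) (fun x => Real.exp (-‖x‖ ^ 2)),
      integral_gaussian_entry, Fintype.card_fin, ← Real.rpow_mul_natCast Real.pi_pos.le]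
    congr 1
    ring
  rw [measure_unitBall_eq_integral_div_gamma μ two_pos, hg, hd, sphereArea,
    ← ENNReal.ofReal_natCast, ← ENNReal.ofReal_mul (Nat.cast_nonneg _)]
  have hpos : (0 : ℝ) < b.beta * (n + 1 : ℕ) := by
    have := beta_pos b
    positivity
  -- For `d = β(n+1)`, the identity `Γ(d/2 + 1) = (d/2) Γ(d/2)` turns `d · π^{d/2} / Γ(d/2 + 1)`
  -- into `σ_d`.
  rw [Nat.cast_mul, Real.Gamma_add_one (by positivity)]
  have := beta_pos b
  congr 1
  field_simp

theorem sphereArea_pos {l : ℝ} (hl : 0 < l) : 0 < sphereArea l := by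
  have := Real.Gamma_pos_of_pos (half_pos hl)
  rw [sphereArea]
  positivity

end Radial

/-! ### Determinants and Gram matrices of block triangular matrices. -/

section Determinant

/-- The block upper triangular matrix with top row `(r, v)` and lower right block `B`. -/
def borderTriangular {R : Type*} [Zero R] {n N : ℕ} (r : R) (v : Fin N → R)
    (B : Matrix (Fin n) (Fin N) R) : Matrix (Fin (n + 1)) (Fin (N + 1)) R :=
  Matrix.of (Fin.cons (Fin.cons r v) fun i => Fin.cons 0 (B i))

theorem det_borderTriangular {R : Type*} [CommRing R] {N : ℕ} (r : R) (v : Fin N → R)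
    (B : Matrix (Fin N) (Fin N) R) : (borderTriangular r v B).det = r * B.det := by
  rw [Matrix.det_succ_column_zero, Fin.sum_univ_succ]
  have : (borderTriangular r v B).submatrix Fin.succ Fin.succ = B := by
    ext i j
    simp [borderTriangular]
  simp [borderTriangular] at this ⊢
  rw [this]

/-- The `2 × 2` complex block of a quaternion. -/
def quaternionBlock (q : ℍ[ℝ]) : Matrix (Fin 2) (Fin 2) ℂ :=
  !![⟨q.re, q.imI⟩, ⟨q.imJ, q.imK⟩; -star ⟨q.imJ, q.imK⟩, star ⟨q.re, q.imI⟩]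

theorem quaternionBlock_add (p q : ℍ[ℝ]) :
    quaternionBlock (p + q) = quaternionBlock p + quaternionBlock q := by
  ext i j
  fin_cases i <;> fin_cases j <;> apply Complex.ext <;> simp [quaternionBlock] <;> ring

theorem quaternionBlock_zero : quaternionBlock 0 = 0 := by
  ext i j
  fin_cases i <;> fin_cases j <;> apply Complex.ext <;> simp [quaternionBlock]

theorem quaternionBlock_mul (p q : ℍ[ℝ]) :
    quaternionBlock (p * q) = quaternionBlock p * quaternionBlock q := by
  ext i j
  fin_cases i <;> fin_cases j <;> apply Complex.ext <;>
    simp [quaternionBlock, Matrix.mul_apply, Fin.sum_univ_two] <;> ring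

theorem quaternionBlock_star (q : ℍ[ℝ]) : quaternionBlock (star q) = (quaternionBlock q)ᴴ := by
  ext i j
  fin_cases i <;> fin_cases j <;> apply Complex.ext <;> simp [quaternionBlock]

theorem complexRep_apply {n N : ℕ} (A : Matrix (Fin n) (Fin N) ℍ[ℝ]) (p : Fin n × Fin 2)
    (q : Fin N × Fin 2) : complexRep A p q = quaternionBlock (A p.1 q.1) p.2 q.2 := rfl

theorem complexRep_mul {l m n : ℕ} (A : Matrix (Fin l) (Fin m) ℍ[ℝ])
    (B : Matrix (Fin m) (Fin n) ℍ[ℝ]) : complexRep (A * B) = complexRep A * complexRep B := by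
  let f : ℍ[ℝ] →+ Matrix (Fin 2) (Fin 2) ℂ :=
    { toFun := quaternionBlock
      map_zero' := quaternionBlock_zero
      map_add' := quaternionBlock_add }
  ext p q
  have h : quaternionBlock (∑ k, A p.1 k * B k q.1) = ∑ k, quaternionBlock (A p.1 k * B k q.1) :=
    map_sum f _ _
  rw [complexRep_apply, Matrix.mul_apply, h, Matrix.mul_apply, Fintype.sum_prod_type,
    Matrix.sum_apply]
  refine Finset.sum_congr rfl fun k _ => ?_
  rw [quaternionBlock_mul, Matrix.mul_apply]
  rfl

theorem complexRep_conjTranspose {n N : ℕ} (A : Matrix (Fin n) (Fin N) ℍ[ℝ]) :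
    complexRep Aᴴ = (complexRep A)ᴴ := by
  ext p q
  rw [complexRep_apply, Matrix.conjTranspose_apply, quaternionBlock_star]
  rfl

/-- Listing the two complex indices of the first row first makes the complex representation block
triangular; its corner is `r` times the `2 × 2` identity, because `r` is real. -/
theorem det_complexRep_borderTriangular {N : ℕ} (r : ℝ) (v : Fin N → ℍ[ℝ])
    (B : Matrix (Fin N) (Fin N) ℍ[ℝ]) :
    (complexRep (borderTriangular (r : ℍ[ℝ]) v B)).det = (r : ℂ) ^ 2 * (complexRep B).det := by
  let f : Fin 2 ⊕ Fin N × Fin 2 → Fin (N + 1) × Fin 2 :=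
    Sum.elim (fun k => (0, k)) fun p => (p.1.succ, p.2)
  have hf : Function.Bijective f := by
    refine ⟨?_, ?_⟩
    · rintro (k | ⟨i, k⟩) (l | ⟨j, l⟩) h <;> simp_all [f, Fin.succ_ne_zero]
      exact absurd h.1.symm (Fin.succ_ne_zero _)
    · rintro ⟨i, k⟩
      refine Fin.cases ⟨Sum.inl k, rfl⟩ (fun i => ⟨Sum.inr (i, k), rfl⟩) i
  rw [← Matrix.det_submatrix_equiv_self (Equiv.ofBijective f hf)]
  have : (complexRep (borderTriangular (r : ℍ[ℝ]) v B)).submatrix (Equiv.ofBijective f hf)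
      (Equiv.ofBijective f hf) = Matrix.fromBlocks (quaternionBlock r)
        (Matrix.of fun k p => quaternionBlock (v p.1) k p.2) 0 (complexRep B) := by
    ext p q
    rcases p with k | ⟨i, k⟩ <;> rcases q with l | ⟨j, l⟩
    · rfl
    · rfl
    · exact congrFun (congrFun quaternionBlock_zero k) l
    · rfl
  rw [this, Matrix.det_fromBlocks_zero₂₁, Matrix.det_fin_two]
  congr 1
  have hr : (⟨r, 0⟩ : ℂ) = r := rfl
  have h0 : (⟨0, 0⟩ : ℂ) = 0 := rfl
  simp [quaternionBlock, hr, h0, sq]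

theorem hermDet_real {N : ℕ} (K : Matrix (Fin N) (Fin N) ℝ) :
    hermDet real (Kᴴ * K : Matrix (Fin N) (Fin N) ℝ) = K.det ^ 2 := by
  change (Kᴴ * K).det = _
  rw [Matrix.det_mul, Matrix.det_conjTranspose, sq]
  rfl

theorem hermDet_complex {N : ℕ} (K : Matrix (Fin N) (Fin N) ℂ) :
    hermDet complex (Kᴴ * K : Matrix (Fin N) (Fin N) ℂ) = ‖K.det‖ ^ 2 := by
  change (Kᴴ * K).det.re = _
  rw [Matrix.det_mul, Matrix.det_conjTranspose, ← Complex.normSq_eq_norm_sq]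
  simp [Complex.normSq_apply]

theorem hermDet_quaternion {N : ℕ} (K : Matrix (Fin N) (Fin N) ℍ[ℝ]) :
    hermDet quaternion (Kᴴ * K : Matrix (Fin N) (Fin N) ℍ[ℝ]) = ‖(complexRep K).det‖ := by
  change Real.sqrt (complexRep (Kᴴ * K)).det.re = _
  have h : (complexRep (Kᴴ * K)).det.re = ‖(complexRep K).det‖ ^ 2 := by
    rw [complexRep_mul, complexRep_conjTranspose, Matrix.det_mul, Matrix.det_conjTranspose,
      ← Complex.normSq_eq_norm_sq]
    simp [Complex.normSq_apply]
  rw [h, Real.sqrt_sq (norm_nonneg _)]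

variable {b : EntryKind} {n N : ℕ}

theorem hermDet_nonneg (K : Matrix (Fin N) (Fin N) b.Entry) : 0 ≤ hermDet b (Kᴴ * K) := by
  cases b
  · exact (hermDet_real K).symm ▸ sq_nonneg _
  · exact (hermDet_complex K).symm ▸ sq_nonneg _
  · exact (hermDet_quaternion K).symm ▸ norm_nonneg _

/-- The factor is `r²` for every `β`: over `ℝ` and `ℂ` it is the square of the corner in `|det K|²`,
over `ℍ` it is the determinant of the `2 × 2` corner, with no further squaring. -/
theorem hermDet_borderTriangular (r : ℝ) (v : Fin N → b.Entry)
    (K : Matrix (Fin N) (Fin N) b.Entry) :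
    hermDet b ((borderTriangular (algebraMap ℝ b.Entry r) v K)ᴴ *
      borderTriangular (algebraMap ℝ b.Entry r) v K) = r ^ 2 * hermDet b (Kᴴ * K) := by
  cases b
  · refine (hermDet_real _).trans ?_
    refine Eq.trans ?_ (congrArg (r ^ 2 * ·) (hermDet_real K)).symm
    refine (congrArg (· ^ 2) (det_borderTriangular (R := ℝ) _ v K)).trans ?_
    exact mul_pow r _ 2
  · refine (hermDet_complex _).trans ?_
    refine Eq.trans ?_ (congrArg (r ^ 2 * ·) (hermDet_complex K)).symm
    refine (congrArg (‖·‖ ^ 2) (det_borderTriangular (R := ℂ) (r : ℂ) v K)).trans ?_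
    rw [norm_mul, mul_pow, Complex.norm_real, Real.norm_eq_abs, sq_abs]
  · refine (hermDet_quaternion _).trans ?_
    refine Eq.trans ?_ (congrArg (r ^ 2 * ·) (hermDet_quaternion K)).symm
    refine (congrArg (‖·‖) (det_complexRep_borderTriangular r v K)).trans ?_
    rw [norm_mul, norm_pow, Complex.norm_real, Real.norm_eq_abs, sq_abs]

theorem hermDet_fin_zero (W : Matrix (Fin 0) (Fin 0) b.Entry) : hermDet b W = 1 := by
  cases b
  · exact Matrix.det_isEmpty (R := ℝ)
  · exact congrArg Complex.re (Matrix.det_isEmpty (R := ℂ) (n := Fin 0) (A := W))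
  · have : (complexRep W).det = 1 := Matrix.det_isEmpty
    change Real.sqrt (complexRep W).det.re = 1
    simp [this]

theorem measurable_hermDet :
    Measurable (hermDet b : Matrix (Fin N) (Fin N) b.Entry → ℝ) := by
  refine Continuous.measurable ?_
  cases b
  · exact Continuous.matrix_det (R := ℝ) (n := Fin N) continuous_id
  · exact Complex.continuous_re.comp (Continuous.matrix_det (R := ℂ) (n := Fin N) continuous_id)
  · refine Real.continuous_sqrt.comp (Complex.continuous_re.comp (Continuous.matrix_det ?_))
    refine continuous_matrix fun p q => ?_
    have hq : Continuous quaternionBlock := by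
      have hc : ∀ f g : ℍ[ℝ] → ℝ, Continuous f → Continuous g →
          Continuous fun q => (⟨f q, g q⟩ : ℂ) := fun f g hf hg =>
        Complex.equivRealProdCLM.symm.continuous.comp (hf.prodMk hg)
      have h1 := hc _ _ Quaternion.continuous_re Quaternion.continuous_imI
      have h2 := hc _ _ Quaternion.continuous_imJ Quaternion.continuous_imK
      refine continuous_matrix fun i j => ?_
      fin_cases i <;> fin_cases j
      · exact h1
      · exact h2
      · exact h2.star.neg
      · exact h1.star
    have he : Continuous fun A : Matrix (Fin N) (Fin N) ℍ[ℝ] => A p.1 q.1 :=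
      continuous_id.matrix_elem _ _
    exact (hq.comp he).matrix_elem p.2 q.2

/-- `(borderTriangular r v B)ᴴ * borderTriangular r v B` as a function of `W = Bᴴ * B`. -/
noncomputable def borderHermitian (r : ℝ) (v : Fin N → b.Entry)
    (W : Matrix (Fin N) (Fin N) b.Entry) : Matrix (Fin (N + 1)) (Fin (N + 1)) b.Entry :=
  (borderTriangular (n := 0) (algebraMap ℝ b.Entry r) v (Matrix.of Fin.elim0))ᴴ *
    borderTriangular (n := 0) (algebraMap ℝ b.Entry r) v (Matrix.of Fin.elim0) +
  borderTriangular 0 0 W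

/-- The top row contributes a rank-one term of its own, so `B` enters only through `Bᴴ * B`. This is
what lets an induction on Gram matrices run with `r` and `v` frozen. -/
theorem conjTranspose_mul_self_borderTriangular (r : ℝ) (v : Fin N → b.Entry)
    (B : Matrix (Fin n) (Fin N) b.Entry) :
    (borderTriangular (algebraMap ℝ b.Entry r) v B)ᴴ *
      borderTriangular (algebraMap ℝ b.Entry r) v B = borderHermitian r v (Bᴴ * B) := by
  ext i j
  rw [borderHermitian, Matrix.add_apply, Matrix.mul_apply, Matrix.mul_apply, Fin.sum_univ_succ,
    Fin.sum_univ_succ, Fin.sum_univ_zero, add_zero]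
  congr 1
  refine Fin.cases ?_ (fun i => ?_) i <;> refine Fin.cases ?_ (fun j => ?_) j <;>
    simp [borderTriangular, Matrix.mul_apply]

theorem continuous_borderTriangular :
    Continuous fun p : (b.Entry × (Fin N → b.Entry)) × Matrix (Fin n) (Fin N) b.Entry =>
      borderTriangular p.1.1 p.1.2 p.2 := by
  refine continuous_matrix fun i j => ?_
  refine Fin.cases ?_ (fun i => ?_) i <;> refine Fin.cases ?_ (fun j => ?_) j
  · exact continuous_fst.fst
  · exact (continuous_apply j).comp continuous_fst.snd
  · exact continuous_const
  · exact continuous_snd.matrix_elem i j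

theorem continuous_borderHermitian :
    Continuous fun p : (ℝ × (Fin N → b.Entry)) × Matrix (Fin N) (Fin N) b.Entry =>
      borderHermitian p.1.1 p.1.2 p.2 := by
  have h := (continuous_borderTriangular (b := b) (n := 0) (N := N)).comp
    (f := fun p : (ℝ × (Fin N → b.Entry)) × Matrix (Fin N) (Fin N) b.Entry =>
      ((algebraMap ℝ b.Entry p.1.1, p.1.2), Matrix.of Fin.elim0))
    ((((continuous_algebraMap ℝ b.Entry).comp continuous_fst.fst).prodMk
      continuous_fst.snd).prodMk continuous_const)
  have h' := (continuous_borderTriangular (b := b) (n := N) (N := N)).comp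
    (f := fun p : (ℝ × (Fin N → b.Entry)) × Matrix (Fin N) (Fin N) b.Entry =>
      (((0 : b.Entry), (0 : Fin N → b.Entry)), p.2)) (continuous_const.prodMk continuous_snd)
  exact (h.matrix_conjTranspose.matrix_mul h).add h'

end Determinant

/-! ### The law of the Gram matrix, by peeling off columns. -/

section Gram

variable {b : EntryKind} {n N : ℕ}

/-- The matrix with first column `a` and remaining columns `B`. -/
def consColumn {R : Type*} (a : Fin n → R) (B : Matrix (Fin n) (Fin N) R) :
    Matrix (Fin n) (Fin (N + 1)) R :=
  Matrix.of fun i => Fin.cons (a i) (B i)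

theorem mul_consColumn {R : Type*} [Semiring R] {m : ℕ} (Q : Matrix (Fin m) (Fin n) R)
    (a : Fin n → R) (B : Matrix (Fin n) (Fin N) R) :
    Q * consColumn a B = consColumn (Q *ᵥ a) (Q * B) := by
  ext i j
  refine Fin.cases ?_ (fun j => ?_) j <;>
    simp [consColumn, Matrix.mul_apply, Matrix.mulVec, dotProduct]

theorem lintegral_lebesgue_consColumn (f : Matrix (Fin n) (Fin (N + 1)) b.Entry → ENNReal) :
    ∫⁻ A, f A ∂b.lebesgue n (N + 1) =
      ∫⁻ p, f (consColumn p.1 p.2)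
        ∂(Measure.pi fun _ : Fin n => b.lebesgueEntry).prod (b.lebesgue n N) := by
  have h1 : MeasurePreserving
      (MeasurableEquiv.piCongrRight fun _ : Fin n =>
        MeasurableEquiv.piFinSuccAbove (fun _ : Fin (N + 1) => b.Entry) 0)
      (Measure.pi fun _ : Fin n => Measure.pi fun _ : Fin (N + 1) => b.lebesgueEntry)
      (Measure.pi fun _ : Fin n =>
        b.lebesgueEntry.prod (Measure.pi fun _ : Fin N => b.lebesgueEntry)) :=
    measurePreserving_pi _ _ fun _ => measurePreserving_piFinSuccAbove
      (fun _ : Fin (N + 1) => b.lebesgueEntry) 0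
  have h2 := measurePreserving_arrowProdEquivProdArrow b.Entry (Fin N → b.Entry) (Fin n)
    (fun _ => b.lebesgueEntry) (fun _ => Measure.pi fun _ : Fin N => b.lebesgueEntry)
  have h := ((h2.comp h1).symm ((MeasurableEquiv.piCongrRight
      fun _ : Fin n => MeasurableEquiv.piFinSuccAbove (fun _ : Fin (N + 1) => b.Entry) 0).trans
      (MeasurableEquiv.arrowProdEquivProdArrow b.Entry (Fin N → b.Entry) (Fin n)))).lintegral_comp_emb
      (MeasurableEquiv.measurableEmbedding _) f
  rw [lebesgue_eq_pi, lebesgue_eq_pi]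
  refine h.symm.trans ?_
  refine lintegral_congr fun p => congrArg f ?_
  ext i j
  refine Fin.cases ?_ (fun j => ?_) j <;> rfl

theorem lintegral_lebesgue_cons (f : Matrix (Fin (n + 1)) (Fin N) b.Entry → ENNReal) :
    ∫⁻ A, f A ∂b.lebesgue (n + 1) N =
      ∫⁻ p, f (Matrix.of (Fin.cons p.1 p.2))
        ∂(Measure.pi fun _ : Fin N => b.lebesgueEntry).prod (b.lebesgue n N) := by
  have h := measurePreserving_piFinSuccAbove
    (fun _ : Fin (n + 1) => Measure.pi fun _ : Fin N => b.lebesgueEntry) 0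
  have h' := (h.symm _).lintegral_comp_emb (MeasurableEquiv.measurableEmbedding _) f
  rw [lebesgue_eq_pi, lebesgue_eq_pi]
  refine h'.symm.trans ?_
  refine lintegral_congr fun p => congrArg f ?_
  ext i j
  refine Fin.cases ?_ (fun i => ?_) i <;> rfl

theorem vecNorm_nonneg (a : Fin n → b.Entry) : 0 ≤ vecNorm a := norm_nonneg _

/-- Every column vector is rotated by some unitary matrix onto the first axis. -/
theorem exists_unitary_mulVec_eq (a : Fin (n + 1) → b.Entry) :
    ∃ Q : b.UnitaryGroup (n + 1),
      Q.1 *ᵥ a = Pi.single 0 (algebraMap ℝ b.Entry (vecNorm a)) := by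
  let E : ℝ → Matrix (Fin (n + 1)) (Fin (n + 1)) b.Entry := fun r =>
    Matrix.single 0 0 (algebraMap ℝ b.Entry r)
  have hE : ∀ r s, E r * E s = E (r * s) := fun r s => by
    simp [E, Matrix.single_mul_single_same]
  have hEs : ∀ r, (E r)ᴴ = E r := fun r => by
    simp only [E, Matrix.conjTranspose_single]
    congr 1
    cases b
    · rfl
    · exact Complex.conj_ofReal r
    · exact Quaternion.star_coe r
  -- The matrix `K` has first column `a` and zeros elsewhere. The root of `Kᴴ * K` has `vecNorm a`
  -- in the corner and zeros elsewhere, so the polar factor `V` carries that multiple of the first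
  -- axis to `a`, and `star V` is the rotation sought.
  let K : Matrix (Fin (n + 1)) (Fin (n + 1)) b.Entry := Matrix.of fun i => Pi.single 0 (a i)
  obtain ⟨V, hV⟩ := exists_polar K
  have hH : IsPosSemidef (E (vecNorm a)) := by
    have := isPosSemidef_conjTranspose_mul_self (E (Real.sqrt (vecNorm a)))
    rwa [hEs, hE, Real.mul_self_sqrt (vecNorm_nonneg a)] at this
  have hHH : E (vecNorm a) * E (vecNorm a) = Kᴴ * K := by
    rw [hE, ← sq, vecNorm_sq]
    ext i j
    refine Fin.cases ?_ (fun i => ?_) i <;> refine Fin.cases ?_ (fun j => ?_) j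
    · rw [conjTranspose_mul_self_apply]
      simp [E, K]
    all_goals simp [E, K, Matrix.mul_apply, (Fin.succ_ne_zero _).symm]
  rw [← sqrt_unique hH hHH] at hV
  refine ⟨star V, ?_⟩
  have hVV : V.1ᴴ * V.1 = 1 := Unitary.star_mul_self_of_mem V.2
  have h : V.1ᴴ * K = E (vecNorm a) := by rw [hV, ← Matrix.mul_assoc, hVV, Matrix.one_mul]
  funext i
  have hi := congrFun (congrFun h i) 0
  have hl : (V.1ᴴ * K) i 0 = (V.1ᴴ *ᵥ a) i := by
    simp [Matrix.mul_apply, Matrix.mulVec, dotProduct, K]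
  rw [hl] at hi
  refine hi.trans ?_
  refine Fin.cases ?_ (fun i => ?_) i <;> simp [E, (Fin.succ_ne_zero _).symm]

theorem consColumn_single (r : b.Entry) (v : Fin N → b.Entry) (B : Matrix (Fin n) (Fin N) b.Entry) :
    consColumn (Pi.single 0 r) (Matrix.of (Fin.cons v B)) = borderTriangular r v B := by
  ext i j
  refine Fin.cases ?_ (fun i => ?_) i <;> refine Fin.cases ?_ (fun j => ?_) j
  · simp [consColumn, borderTriangular]
  · rfl
  · simp [consColumn, borderTriangular]
  · rfl

theorem measurable_gram : Measurable fun A : Matrix (Fin n) (Fin N) b.Entry => Aᴴ * A := by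
  have : Continuous fun A : Matrix (Fin n) (Fin N) b.Entry => Aᴴ * A := by fun_prop
  exact this.measurable

/-- Rotating all columns together leaves the Gram matrix unchanged, and the rotation of `B` is
absorbed by the invariance of Lebesgue measure. Hence the result depends on `a` only through its
norm. -/
theorem lintegral_gram_consColumn (a : Fin (n + 1) → b.Entry)
    {g : Matrix (Fin (N + 1)) (Fin (N + 1)) b.Entry → ENNReal} (hg : Measurable g) :
    ∫⁻ B, g ((consColumn a B)ᴴ * consColumn a B) ∂b.lebesgue (n + 1) N =
      ∫⁻ p, g (borderHermitian (vecNorm a) p.1 (p.2ᴴ * p.2))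
        ∂(Measure.pi fun _ : Fin N => b.lebesgueEntry).prod (b.lebesgue n N) := by
  obtain ⟨Q, hQ⟩ := exists_unitary_mulVec_eq a
  set e : Fin (n + 1) → b.Entry := Pi.single 0 (algebraMap ℝ b.Entry (vecNorm a)) with he
  have hm : Measurable fun B : Matrix (Fin (n + 1)) (Fin N) b.Entry =>
      g ((consColumn e B)ᴴ * consColumn e B) := by
    refine hg.comp (measurable_gram.comp (Continuous.measurable ?_))
    refine continuous_matrix fun i j => ?_
    refine Fin.cases ?_ (fun j => ?_) j
    · exact continuous_const
    · exact continuous_id.matrix_elem i j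
  calc
    _ = ∫⁻ B, g ((consColumn e (Q.1 * B))ᴴ * consColumn e (Q.1 * B)) ∂b.lebesgue (n + 1) N := by
      refine lintegral_congr fun B => ?_
      rw [← hQ, ← mul_consColumn, conjTranspose_mul_self_unitary_mul]
    _ = ∫⁻ B, g ((consColumn e B)ᴴ * consColumn e B) ∂b.lebesgue (n + 1) N :=
      (measurePreserving_unitary_mul Q).lintegral_comp hm
    _ = _ := by
      rw [lintegral_lebesgue_cons]
      refine lintegral_congr fun p => ?_
      rw [he, consColumn_single, conjTranspose_mul_self_borderTriangular]

theorem measurable_borderHermitian :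
    Measurable fun p : (ℝ × (Fin N → b.Entry)) × Matrix (Fin N) (Fin N) b.Entry =>
      borderHermitian p.1.1 p.1.2 p.2 :=
  continuous_borderHermitian.measurable

theorem measurable_borderHermitian_gram
    {g : Matrix (Fin (N + 1)) (Fin (N + 1)) b.Entry → ENNReal} (hg : Measurable g) :
    Measurable fun p : (ℝ × (Fin N → b.Entry)) × Matrix (Fin n) (Fin N) b.Entry =>
      g (borderHermitian p.1.1 p.1.2 (p.2ᴴ * p.2)) := by
  have h : Measurable fun p : (ℝ × (Fin N → b.Entry)) × Matrix (Fin n) (Fin N) b.Entry =>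
      (p.1, p.2ᴴ * p.2) := by
    refine Measurable.prodMk measurable_fst ?_
    exact measurable_gram.comp measurable_snd
  simpa only [Function.comp_def] using
    (hg.comp (measurable_borderHermitian (b := b) (N := N))).comp h

theorem lintegral_gram_succ {g : Matrix (Fin (N + 1)) (Fin (N + 1)) b.Entry → ENNReal}
    (hg : Measurable g) :
    ∫⁻ A, g (Aᴴ * A) ∂b.lebesgue (n + 1) (N + 1) =
      ENNReal.ofReal (sphereArea (b.beta * (n + 1 : ℕ))) *
        ∫⁻ r in Set.Ioi (0 : ℝ), ENNReal.ofReal (r ^ (b.beta * (n + 1) - 1)) *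
          ∫⁻ v, ∫⁻ B, g (borderHermitian r v (Bᴴ * B)) ∂b.lebesgue n N
            ∂Measure.pi fun _ : Fin N => b.lebesgueEntry := by
  have hm := measurable_borderHermitian_gram (n := n) hg
  have hc : Continuous fun p : (Fin (n + 1) → b.Entry) × Matrix (Fin (n + 1)) (Fin N) b.Entry =>
      consColumn p.1 p.2 := by
    refine continuous_matrix fun i j => ?_
    refine Fin.cases ?_ (fun j => ?_) j
    · exact (continuous_apply i).comp continuous_fst
    · exact continuous_snd.matrix_elem i j
  have hgc : Measurable fun p : (Fin (n + 1) → b.Entry) × Matrix (Fin (n + 1)) (Fin N) b.Entry =>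
      g ((consColumn p.1 p.2)ᴴ * consColumn p.1 p.2) :=
    hg.comp (measurable_gram.comp hc.measurable)
  rw [← lintegral_vecNorm n hm.lintegral_prod_right'.lintegral_prod_right',
    lintegral_lebesgue_consColumn, lintegral_prod _ hgc.aemeasurable]
  refine lintegral_congr fun a => ?_
  rw [lintegral_gram_consColumn a hg, lintegral_prod]
  exact (hm.comp ((measurable_const.prodMk measurable_fst).prodMk measurable_snd)).aemeasurable

theorem prod_sphereArea_succ (b : EntryKind) (n N : ℕ) :
    (∏ i ∈ Finset.Icc 1 (N + 1), sphereArea ((b.beta : ℝ) * (((n + 1 : ℕ) : ℝ) - i + 1)) /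
        sphereArea ((b.beta : ℝ) * (((N + 1 : ℕ) : ℝ) - i + 1))) =
      sphereArea (b.beta * (n + 1 : ℕ)) / sphereArea (b.beta * (N + 1 : ℕ)) *
      ∏ i ∈ Finset.Icc 1 N, sphereArea ((b.beta : ℝ) * ((n : ℝ) - i + 1)) /
        sphereArea ((b.beta : ℝ) * ((N : ℝ) - i + 1)) := by
  have h : ∀ M : ℕ, Finset.Icc 1 M = Finset.Ico 1 (M + 1) := fun M => by
    ext i; simp
  rw [h, h, Finset.prod_Ico_eq_prod_range, Finset.prod_Ico_eq_prod_range, Nat.add_sub_cancel,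
    Nat.add_sub_cancel, Finset.prod_range_succ', mul_comm]
  congr 1
  · simp
  · refine Finset.prod_congr rfl fun i _ => ?_
    push_cast
    ring_nf

/-- The law of `Aᴴ * A` for `n × N` matrices, in terms of that for `N × N` matrices. -/
theorem lintegral_gram (hnN : N ≤ n) {g : Matrix (Fin N) (Fin N) b.Entry → ENNReal}
    (hg : Measurable g) :
    ∫⁻ A, g (Aᴴ * A) ∂b.lebesgue n N =
      ENNReal.ofReal (∏ i ∈ Finset.Icc 1 N, sphereArea ((b.beta : ℝ) * ((n : ℝ) - i + 1)) /
            sphereArea ((b.beta : ℝ) * ((N : ℝ) - i + 1))) *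
        ∫⁻ K, ENNReal.ofReal (hermDet b (Kᴴ * K) ^ ((b.beta : ℝ) * ((n : ℝ) - N) / 2)) *
          g (Kᴴ * K) ∂b.lebesgue N N := by
  induction N generalizing n with
  | zero =>
    -- Matrices without columns form a single point of mass one, and the empty determinant is `1`,
    -- so both sides equal `g 0`.
    have hp : ∀ m, IsProbabilityMeasure (b.lebesgue m 0) := fun m => by
      have : IsProbabilityMeasure (Measure.pi fun _ : Fin 0 => b.lebesgueEntry) := ⟨by simp⟩
      rw [lebesgue_eq_pi]
      exact Measure.pi.instIsProbabilityMeasure (α := fun _ : Fin m => Fin 0 → b.Entry) _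
    have h0 : ∀ W : Matrix (Fin 0) (Fin 0) b.Entry, W = 0 := fun W => Subsingleton.elim _ _
    have h1 : ∀ m, ∀ A : Matrix (Fin m) (Fin 0) b.Entry, Aᴴ * A = 0 := fun m A => h0 _
    simp [h1, hermDet_fin_zero]
  | succ N ih =>
    obtain ⟨n, rfl⟩ : ∃ m, n = m + 1 := ⟨n - 1, by omega⟩
    have hNn : N ≤ n := by omega
    have hβ := beta_pos b
    set a : ℝ := (b.beta : ℝ) * ((n : ℝ) - N) / 2 with ha
    have ha' : (b.beta : ℝ) * (((n + 1 : ℕ) : ℝ) - (N + 1 : ℕ)) / 2 = a := by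
      rw [ha]; push_cast; ring
    rw [ha', prod_sphereArea_succ]
    set c : ℝ := ∏ i ∈ Finset.Icc 1 N, sphereArea ((b.beta : ℝ) * ((n : ℝ) - i + 1)) /
        sphereArea ((b.beta : ℝ) * ((N : ℝ) - i + 1)) with hc
    have hd : Measurable fun W : Matrix (Fin (N + 1)) (Fin (N + 1)) b.Entry =>
        ENNReal.ofReal (hermDet b W ^ a) * g W :=
      (measurable_hermDet.pow_const a).ennreal_ofReal.mul hg
    have hs1 : 0 < sphereArea ((b.beta : ℝ) * (n + 1 : ℕ)) := sphereArea_pos (by positivity)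
    have hs2 : 0 < sphereArea ((b.beta : ℝ) * (N + 1 : ℕ)) := sphereArea_pos (by positivity)
    -- The peeling step is applied on both sides; the new sphere-area ratio accounts for the two
    -- different surface constants, leaving a comparison of radial integrands at each `r`.
    rw [lintegral_gram_succ hg, lintegral_gram_succ hd, ← mul_assoc,
      ← ENNReal.ofReal_mul' hs2.le, mul_right_comm, div_mul_cancel₀ _ hs2.ne',
      ENNReal.ofReal_mul hs1.le, mul_assoc]
    congr 1
    rw [← lintegral_const_mul' _ _ ENNReal.ofReal_ne_top]
    refine setLIntegral_congr_fun measurableSet_Ioi fun r (hr : 0 < r) => ?_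
    have h1 : ∀ v : Fin N → b.Entry,
        ∫⁻ B, g (borderHermitian r v (Bᴴ * B)) ∂b.lebesgue n N =
        ENNReal.ofReal c * ∫⁻ K, ENNReal.ofReal (hermDet b (Kᴴ * K) ^ a) *
          g (borderHermitian r v (Kᴴ * K)) ∂b.lebesgue N N := fun v =>
      -- The exponent `a` is common to both levels, since `(n+1) - (N+1) = n - N`.
      ih hNn (g := fun W => g (borderHermitian r v W)) (by
        simpa only [Function.comp_def] using
          (hg.comp (measurable_borderHermitian (b := b) (N := N))).comp
            (measurable_prodMk_left (x := (r, v))))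
    have h2 : ∀ v : Fin N → b.Entry,
        ∫⁻ K, ENNReal.ofReal (hermDet b (borderHermitian r v (Kᴴ * K)) ^ a) *
          g (borderHermitian r v (Kᴴ * K)) ∂b.lebesgue N N =
        ENNReal.ofReal (r ^ (b.beta * (n - N))) *
          ∫⁻ K, ENNReal.ofReal (hermDet b (Kᴴ * K) ^ a) *
            g (borderHermitian r v (Kᴴ * K)) ∂b.lebesgue N N := by
      intro v
      rw [← lintegral_const_mul' _ _ ENNReal.ofReal_ne_top]
      refine lintegral_congr fun K => ?_
      rw [← mul_assoc, ← ENNReal.ofReal_mul (by positivity),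
        ← conjTranspose_mul_self_borderTriangular, hermDet_borderTriangular,
        Real.mul_rpow (sq_nonneg r) (hermDet_nonneg K)]
      congr 3
      rw [← Real.rpow_natCast, ← Real.rpow_natCast, ← Real.rpow_mul hr.le, ha]
      congr 1
      push_cast [Nat.cast_sub hNn]
      ring
    simp only [h1, h2]
    -- The excess of the radial power for `n + 1` rows over that for `N + 1` rows is the power of
    -- `r` extracted from the determinant. Positivity of `β(N+1)` keeps the truncated subtraction
    -- exact.
    have he : b.beta * (n + 1) - 1 = b.beta * (N + 1) - 1 + b.beta * (n - N) := by
      have h3 : b.beta * (n + 1) = b.beta * (N + 1) + b.beta * (n - N) := by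
        rw [← mul_add]; congr 1; omega
      have h4 : 0 < b.beta * (N + 1) := by positivity
      omega
    rw [lintegral_const_mul' _ _ ENNReal.ofReal_ne_top,
      lintegral_const_mul' _ _ ENNReal.ofReal_ne_top, he, pow_add, ENNReal.ofReal_mul (by positivity)]
    ring

end Gram

/-! ### Haar averaging and the density of the polar product. -/

section Main

variable {b : EntryKind} {n N : ℕ}

theorem sqrt_conjTranspose_mul_sqrt (A : Matrix (Fin n) (Fin N) b.Entry) :
    (sqrt (Aᴴ * A))ᴴ * sqrt (Aᴴ * A) = Aᴴ * A := by
  obtain ⟨h1, h2⟩ := sqrt_spec (isPosSemidef_conjTranspose_mul_self A)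
  have h : (sqrt (Aᴴ * A))ᴴ = sqrt (Aᴴ * A) := h1.1
  rw [h, h2]

/-- Appending zero rows embeds `N × N` matrices into `n × N` matrices. -/
theorem exists_measurable_gram_eq (hnN : N ≤ n) :
    ∃ pad : Matrix (Fin N) (Fin N) b.Entry → Matrix (Fin n) (Fin N) b.Entry,
      Measurable pad ∧ ∀ K, (pad K)ᴴ * pad K = Kᴴ * K := by
  obtain ⟨m, rfl⟩ := Nat.exists_eq_add_of_le hnN
  let pad : Matrix (Fin N) (Fin N) b.Entry → Matrix (Fin (N + m)) (Fin N) b.Entry :=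
    fun K => Matrix.of (Fin.append K 0)
  have hl : ∀ K i j, pad K (Fin.castAdd m i) j = K i j := fun K i j =>
    congrFun (Fin.append_left (α := Fin N → b.Entry) K 0 i) j
  have hr : ∀ K i j, pad K (Fin.natAdd N i) j = 0 := fun K i j =>
    congrFun (Fin.append_right (α := Fin N → b.Entry) K 0 i) j
  have hc : Continuous pad := by
    refine continuous_matrix fun i j => ?_
    refine Fin.addCases (fun i => ?_) (fun i => ?_) i
    · simp only [hl]
      exact continuous_id.matrix_elem i j
    · simp only [hr]
      exact continuous_const
  refine ⟨pad, hc.measurable, fun K => ?_⟩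
  ext i j
  simp [Matrix.mul_apply, Fin.sum_univ_add, hl, hr]

/-- `P` itself need not be measurable: only its composition with the Gram map of `n × N` matrices is
controlled. Padding with zero rows transfers this to square matrices. -/
theorem measurable_gram_square (hnN : N ≤ n) {P : Matrix (Fin N) (Fin N) b.Entry → ℝ}
    (hP : Measurable fun A : Matrix (Fin n) (Fin N) b.Entry => P (Aᴴ * A)) :
    Measurable fun K : Matrix (Fin N) (Fin N) b.Entry => P (Kᴴ * K) := by
  obtain ⟨pad, hm, hpad⟩ := exists_measurable_gram_eq (b := b) hnN
  simpa only [Function.comp_def, hpad] using hP.comp hm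

theorem prod_sphereArea_nonneg (b : EntryKind) (hnN : N ≤ n) :
    0 ≤ ∏ i ∈ Finset.Icc 1 N, sphereArea ((b.beta : ℝ) * ((n : ℝ) - i + 1)) /
      sphereArea ((b.beta : ℝ) * ((N : ℝ) - i + 1)) := by
  refine Finset.prod_nonneg fun i hi => ?_
  obtain ⟨_, hi⟩ := Finset.mem_Icc.1 hi
  have hβ : (0 : ℝ) < b.beta := Nat.cast_pos.2 (beta_pos b)
  have hi' : (i : ℝ) ≤ N := Nat.cast_le.2 hi
  have hn' : (N : ℝ) ≤ n := Nat.cast_le.2 hnN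
  exact div_nonneg (sphereArea_pos (mul_pos hβ (by linarith))).le
    (sphereArea_pos (mul_pos hβ (by linarith))).le

theorem continuous_unitary_mul :
    Continuous fun p : b.UnitaryGroup N × Matrix (Fin N) (Fin N) b.Entry => p.1.1 * p.2 :=
  (continuous_subtype_val.comp continuous_fst).matrix_mul continuous_snd

/-- If `U` is Haar distributed, then `U * (Kᴴ * K)^{1/2}` and `U * K` have the same law. -/
theorem lintegral_unitary_mul_sqrt (ν : Measure (b.UnitaryGroup N)) [IsProbabilityMeasure ν]
    [ν.IsHaarMeasure] {f : Matrix (Fin N) (Fin N) b.Entry → ENNReal} (hf : Measurable f)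
    (K : Matrix (Fin N) (Fin N) b.Entry) :
    ∫⁻ u, f (u.1 * sqrt (Kᴴ * K)) ∂ν = ∫⁻ u, f (u.1 * K) ∂ν := by
  obtain ⟨V, hV⟩ := exists_polar K
  -- Haar measure on a compact group is right invariant: the right translate is again a
  -- left-invariant probability measure, and uniqueness applies.
  have h : ν.map (· * V) = ν := by
    have : IsProbabilityMeasure (ν.map (· * V)) :=
      Measure.isProbabilityMeasure_map (continuous_mul_const V).aemeasurable
    have := Measure.isMulInvariant_eq_smul_of_compactSpace (ν.map (· * V)) ν
    have h1 := congrArg (fun μ => μ Set.univ) this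
    simp only [Measure.smul_apply, measure_univ] at h1
    have h2 : ((ν.map (· * V)).haarScalarFactor ν : ENNReal) = 1 := by
      rw [ENNReal.smul_def, smul_eq_mul, mul_one] at h1
      exact h1.symm
    rw [this, ENNReal.coe_eq_one.1 h2, one_smul]
  have hm : Measurable fun u : b.UnitaryGroup N => f (u.1 * sqrt (Kᴴ * K)) :=
    hf.comp (continuous_unitary_mul.comp (Continuous.prodMk_left (sqrt (Kᴴ * K)))).measurable
  calc
    _ = ∫⁻ u, f (u.1 * sqrt (Kᴴ * K)) ∂ν.map (· * V) := by rw [h]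
    _ = ∫⁻ u, f ((u * V).1 * sqrt (Kᴴ * K)) ∂ν :=
      lintegral_map hm (continuous_mul_const V).measurable
    _ = _ := by
      refine lintegral_congr fun u => ?_
      conv_rhs => rw [hV, ← Matrix.mul_assoc]
      rfl

/-- Averaging over unitary matrices does not change the integral against a density that is a
function of `Kᴴ * K`. -/
theorem lintegral_unitary_average (ν : Measure (b.UnitaryGroup N)) [IsProbabilityMeasure ν]
    {f d : Matrix (Fin N) (Fin N) b.Entry → ENNReal} (hf : Measurable f) (hd : Measurable d)
    (hinv : ∀ (u : b.UnitaryGroup N) K, d (u.1 * K) = d K) :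
    ∫⁻ K, d K * ∫⁻ u, f (u.1 * K) ∂ν ∂b.lebesgue N N = ∫⁻ K, d K * f K ∂b.lebesgue N N := by
  have hm : Measurable fun p : Matrix (Fin N) (Fin N) b.Entry × b.UnitaryGroup N =>
      d p.1 * f (p.2.1 * p.1) :=
    (hd.comp measurable_fst).mul
      (hf.comp (continuous_unitary_mul.measurable.comp measurable_swap))
  calc
    _ = ∫⁻ K, ∫⁻ u, d K * f (u.1 * K) ∂ν ∂b.lebesgue N N := by
      refine lintegral_congr fun K => (lintegral_const_mul _ ?_).symm
      exact hf.comp (continuous_unitary_mul.comp (Continuous.prodMk_left K)).measurable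
    _ = ∫⁻ u, ∫⁻ K, d K * f (u.1 * K) ∂b.lebesgue N N ∂ν :=
      lintegral_lintegral_swap hm.aemeasurable
    _ = ∫⁻ _, ∫⁻ K, d K * f K ∂b.lebesgue N N ∂ν := by
      refine lintegral_congr fun u => ?_
      -- After Tonelli, `u` is fixed and the substitution `K ↦ u * K` preserves both the measure and
      -- `d`.
      refine Eq.trans (lintegral_congr fun K => ?_)
        ((measurePreserving_unitary_mul u).lintegral_comp (hd.mul hf))
      simp only [hinv]
    _ = _ := by rw [lintegral_const, measure_univ, mul_one]

/-- For fixed `A` the average over `u` depends only on `Aᴴ * A`, so `lintegral_gram` moves the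
integral to square matrices, where the root can be traded for `K` and the average dropped. -/
theorem lintegral_haar_mul_sqrt (hnN : N ≤ n) (ν : Measure (b.UnitaryGroup N))
    [IsProbabilityMeasure ν] [ν.IsHaarMeasure] {P : Matrix (Fin N) (Fin N) b.Entry → ℝ}
    (hP : Measurable fun A : Matrix (Fin n) (Fin N) b.Entry => P (Aᴴ * A))
    {f : Matrix (Fin N) (Fin N) b.Entry → ENNReal} (hf : Measurable f) :
    ∫⁻ A, ENNReal.ofReal (P (Aᴴ * A)) * ∫⁻ u, f (u.1 * sqrt (Aᴴ * A)) ∂ν ∂b.lebesgue n N =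
      ∫⁻ K, ENNReal.ofReal ((∏ i ∈ Finset.Icc 1 N,
          sphereArea ((b.beta : ℝ) * ((n : ℝ) - i + 1)) /
            sphereArea ((b.beta : ℝ) * ((N : ℝ) - i + 1))) *
        hermDet b (Kᴴ * K) ^ ((b.beta : ℝ) * ((n : ℝ) - N) / 2) * P (Kᴴ * K)) * f K
        ∂b.lebesgue N N := by
  have hPN := measurable_gram_square hnN hP
  set a : ℝ := (b.beta : ℝ) * ((n : ℝ) - N) / 2
  set c : ℝ := ∏ i ∈ Finset.Icc 1 N, sphereArea ((b.beta : ℝ) * ((n : ℝ) - i + 1)) /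
    sphereArea ((b.beta : ℝ) * ((N : ℝ) - i + 1))
  have hc0 : 0 ≤ c := prod_sphereArea_nonneg b hnN
  let G : Matrix (Fin N) (Fin N) b.Entry → ENNReal := fun W => ∫⁻ u, f (u.1 * sqrt W) ∂ν
  have hG : Measurable G := by
    have h : Measurable fun p : Matrix (Fin N) (Fin N) b.Entry × b.UnitaryGroup N =>
        f (p.2.1 * sqrt p.1) :=
      hf.comp (continuous_unitary_mul.measurable.comp
        (measurable_snd.prodMk (measurable_sqrt.comp measurable_fst)))
    exact h.lintegral_prod_right'
  -- Writing `P ((sqrt W)ᴴ * sqrt W)` instead of `P W` makes `g` measurable on all matrices while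
  -- leaving it unchanged on Gram matrices.
  let g : Matrix (Fin N) (Fin N) b.Entry → ENNReal := fun W =>
    ENNReal.ofReal (P ((sqrt W)ᴴ * sqrt W)) * G W
  have hg : Measurable g := ((hPN.comp measurable_sqrt).ennreal_ofReal).mul hG
  have hgA : ∀ {m : ℕ} (A : Matrix (Fin m) (Fin N) b.Entry),
      g (Aᴴ * A) = ENNReal.ofReal (P (Aᴴ * A)) * G (Aᴴ * A) := fun A => by
    simp only [g]
    rw [sqrt_conjTranspose_mul_sqrt]
  have hD : Measurable fun K : Matrix (Fin N) (Fin N) b.Entry =>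
      ENNReal.ofReal (hermDet b (Kᴴ * K) ^ a) * ENNReal.ofReal (P (Kᴴ * K)) :=
    (((measurable_hermDet.comp measurable_gram).pow_const a).ennreal_ofReal).mul hPN.ennreal_ofReal
  calc
    _ = ∫⁻ A, g (Aᴴ * A) ∂b.lebesgue n N := lintegral_congr fun A => (hgA A).symm
    _ = ENNReal.ofReal c * ∫⁻ K, ENNReal.ofReal (hermDet b (Kᴴ * K) ^ a) * g (Kᴴ * K)
        ∂b.lebesgue N N := lintegral_gram hnN hg
    _ = ENNReal.ofReal c * ∫⁻ K, (ENNReal.ofReal (hermDet b (Kᴴ * K) ^ a) *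
        ENNReal.ofReal (P (Kᴴ * K))) * ∫⁻ u, f (u.1 * K) ∂ν ∂b.lebesgue N N := by
      congr 1
      refine lintegral_congr fun K => ?_
      rw [hgA, mul_assoc, ← lintegral_unitary_mul_sqrt ν hf K]
    _ = ENNReal.ofReal c * ∫⁻ K, (ENNReal.ofReal (hermDet b (Kᴴ * K) ^ a) *
        ENNReal.ofReal (P (Kᴴ * K))) * f K ∂b.lebesgue N N := by
      rw [lintegral_unitary_average ν hf hD fun u K => by
        rw [conjTranspose_mul_self_unitary_mul]]
    _ = _ := by
      rw [← lintegral_const_mul' _ _ ENNReal.ofReal_ne_top]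
      refine lintegral_congr fun K => ?_
      have hd : 0 ≤ hermDet b (Kᴴ * K) ^ a := Real.rpow_nonneg (hermDet_nonneg K) a
      rw [ENNReal.ofReal_mul (mul_nonneg hc0 hd), ENNReal.ofReal_mul hc0]
      ring

end Main

end EntryKind

theorem mainTheorem8 (b : EntryKind) (n N : ℕ) (hnN : N ≤ n)
    {Ω : Type*} [MeasurableSpace Ω] (μ : Measure Ω) [IsProbabilityMeasure μ]
    (P : Matrix (Fin N) (Fin N) b.Entry → ℝ)
    (M : Ω → Matrix (Fin n) (Fin N) b.Entry)
    (hM : EntryKind.HasDensity M μ (fun A => P (Aᴴ * A)))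
    (U : Ω → b.UnitaryGroup N) (hUm : AEMeasurable U μ)
    (hU : (μ.map U).IsHaarMeasure) (hUM : IndepFun U M μ) :
    EntryKind.HasDensity
      (fun ω => (U ω : Matrix (Fin N) (Fin N) b.Entry) * EntryKind.sqrt ((M ω)ᴴ * M ω)) μ
      (fun K => (∏ i ∈ Finset.Icc 1 N,
          sphereArea ((b.beta : ℝ) * ((n : ℝ) - i + 1)) /
            sphereArea ((b.beta : ℝ) * ((N : ℝ) - i + 1))) *
        EntryKind.hermDet b (Kᴴ * K) ^ ((b.beta : ℝ) * ((n : ℝ) - N) / 2) * P (Kᴴ * K)) := by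
  obtain ⟨hMm, hPm, hP0, hMd⟩ := hM
  have hPN := EntryKind.measurable_gram_square hnN hPm
  have hΦ : Measurable fun p : b.UnitaryGroup N × Matrix (Fin n) (Fin N) b.Entry =>
      p.1.1 * EntryKind.sqrt (p.2ᴴ * p.2) :=
    EntryKind.continuous_unitary_mul.measurable.comp (measurable_fst.prodMk
      (EntryKind.measurable_sqrt.comp (EntryKind.measurable_gram.comp measurable_snd)))
  have hdm : Measurable fun K : Matrix (Fin N) (Fin N) b.Entry => (∏ i ∈ Finset.Icc 1 N,
          sphereArea ((b.beta : ℝ) * ((n : ℝ) - i + 1)) /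
            sphereArea ((b.beta : ℝ) * ((N : ℝ) - i + 1))) *
        EntryKind.hermDet b (Kᴴ * K) ^ ((b.beta : ℝ) * ((n : ℝ) - N) / 2) * P (Kᴴ * K) :=
    (((EntryKind.measurable_hermDet.comp EntryKind.measurable_gram).pow_const _).const_mul _).mul hPN
  refine ⟨hΦ.comp_aemeasurable (hUm.prodMk hMm), hdm, fun K => ?_, ?_⟩
  -- Nonnegativity of `P` is known only at Gram matrices of `n × N` matrices, hence the padding of
  -- `K`.
  · obtain ⟨pad, -, hpad⟩ := EntryKind.exists_measurable_gram_eq (b := b) hnN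
    have hP : 0 ≤ P (Kᴴ * K) := hpad K ▸ hP0 (pad K)
    exact mul_nonneg (mul_nonneg (EntryKind.prod_sphereArea_nonneg b hnN)
      (Real.rpow_nonneg (EntryKind.hermDet_nonneg K) _)) hP
  · have : IsProbabilityMeasure (μ.map U) := Measure.isProbabilityMeasure_map hUm
    -- Independence makes the joint law of `(U, M)` a product, so the average over `U` can be taken
    -- with `M` fixed.
    have hmap : μ.map (fun ω => (U ω : Matrix (Fin N) (Fin N) b.Entry) *
        EntryKind.sqrt ((M ω)ᴴ * M ω)) = ((μ.map U).prod (μ.map M)).map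
          fun p => p.1.1 * EntryKind.sqrt (p.2ᴴ * p.2) := by
      rw [← (indepFun_iff_map_prod_eq_prod_map_map hUm hMm).1 hUM,
        AEMeasurable.map_map_of_aemeasurable hΦ.aemeasurable (hUm.prodMk hMm)]
      rfl
    have : IsProbabilityMeasure (μ.map M) := Measure.isProbabilityMeasure_map hMm
    refine Measure.ext_of_lintegral _ fun f hf => ?_
    have hfΦ : Measurable fun p : b.UnitaryGroup N × Matrix (Fin n) (Fin N) b.Entry =>
      f (p.1.1 * EntryKind.sqrt (p.2ᴴ * p.2)) := hf.comp hΦ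
    rw [hmap, lintegral_map hf hΦ, lintegral_prod_symm' _ hfΦ, hMd,
      lintegral_withDensity_eq_lintegral_mul _ hPm.ennreal_ofReal hfΦ.lintegral_prod_left',
      lintegral_withDensity_eq_lintegral_mul _ hdm.ennreal_ofReal hf]
    exact EntryKind.lintegral_haar_mul_sqrt hnN (μ.map U) hPm hf
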